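/- A linear order is \emph{scattered} if the order of the rational numbers does not embed into it. For a linear order $\mathfrak{L}$ define $x\sim_0 y$ iff $x=y$; $x\sim_{\alpha+1}y$ iff the closed interval between the classes of $x$ and $y$ in $\mathfrak{L}/{\sim_\alpha}$ is finite; and, for a limit ordinal $\beta$, $x\sim_\beta y$ iff $x\sim_\alpha y$ for some $\alpha<\beta$. For scattered $\mathfrak{L}$ let $\mathsf{FC}_*(\mathfrak{L})$ be the least ordinal $\alpha$ such that $\mathfrak{L}/{\sim_\alpha}$ is finite (such an ordinal exists). An $\mathfrak{L}$-word over a finite alphabet is a map from $\mathfrak{L}$ to that alphabet; if the alphabet contains a distinguished blank symbol $\diamond$, the word is \emph{finite} if it takes values different from $\diamond$ at only finitely many positions. Convolution is $(w\otimes v)(l)=(w(l),v(l))$. A cut of $\mathfrak{L}=(L,\le)$ is a pair $(C,L\setminus C)$ with $C\subseteq L$ downward closed; cuts are ordered by inclusion of $C$. An automaton over a finite alphabet $\Sigma$ has a finite state set $Q$, sets $I,F\subseteq Q$ of initial and final states, and a transition relation $\Delta\subseteq(Q\times\Sigma\times Q)\cup(2^Q\times Q)\cup(Q\times 2^Q)$.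 A run on an $\mathfrak{L}$-word $w$ is a map $r$ from the cuts of $\mathfrak{L}$ to $Q$ such that (i) $(r(c),w(l),r(d))\in\Delta$ for every $l\in L$, where $c,d$ are the cuts with lower parts $\{x<l\}$ and $\{x\le l\}$; (ii) $(\lim_{c^-}r,\,r(c))\in\Delta$ for every cut $c\neq(\emptyset,L)$ without direct predecessor; and (iii) $(r(c),\lim_{c^+}r)\in\Delta$ for every cut $c\neq(L,\emptyset)$ without direct successor. Here $\lim_{c^-}r$ (respectively $\lim_{c^+}r$) is the set of states that $r$ takes at cuts arbitrarily close to $c$ from below (respectively above). The word $w$ is accepted if there is a run $r$ on it with $r((\emptyset,L))\in I$ and $r((L,\emptyset))\in F$. A linear order $\mathfrak{A}$ is \emph{finite word $\mathfrak{L}$-oracle-automatic} if there are an $\mathfrak{L}$-word $o$ (the oracle) over some finite alphabet, a finite alphabet $\Sigma$ with a blank symbol, two automata $\mathcal{M},\mathcal{N}$, and an isomorphism of $\mathfrak{A}$ with a linear order $(A,\le)$ such that $A$ is a set of finite $\mathfrak{L}$-words over $\Sigma$, $A=\{w\mid w\otimes o\text{ is accepted by }\mathcal{M}\}$, and $\{(w,v)\in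 A^2\mid w\le v\}=\{(w,v)\mid w\otimes v\otimes o\text{ is accepted by }\mathcal{N}\}$. \textbf{Theorem.} Let $\mathfrak{L}$ be a scattered linear order. (1) Suppose $\mathsf{FC}_*(\mathfrak{L})=1+\alpha$ for an ordinal $\alpha$. Then every finite word $\mathfrak{L}$-oracle-automatic scattered linear order $\mathfrak{A}$ satisfies $\mathsf{FC}_*(\mathfrak{A})<\omega^{\alpha+1}$. In particular, every finite word $\mathfrak{L}$-oracle-automatic ordinal is smaller than $\omega^{\omega^{\alpha+1}}$. (2) Suppose $\mathsf{FC}_*(\mathfrak{L})=0$. Then every finite word $\mathfrak{L}$-oracle-automatic scattered linear order $\mathfrak{A}$ satisfies $\mathsf{FC}_*(\mathfrak{A})<\omega^0=1$, i.e. $\mathfrak{A}$ is finite. -/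

import Mathlib

universe u v

namespace ScatteredAutomatic

/-! ## Scattered linear orders and finite condensation rank -/

/-- A linear order is scattered if the rationals do not embed into it. -/
def IsScattered (L : Type u) [LinearOrder L] : Prop :=
  IsEmpty (ℚ ↪o L)

section Condensation

variable (L : Type u) [LinearOrder L]

/-- The `α`-th condensation `x ∼_α y`, by transfinite recursion:
* `x ∼_0 y` iff `x = y`;
* `x ∼_{α+1} y` iff the closed interval between the classes of `x` and `y` in `L/∼_α` is finite,
  that is, only finitely many `∼_α`-classes `{w | z ∼_α w}` are represented by points `z` of the
  closed interval between `x` and `y`;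
* `x ∼_β y`, for a limit `β`, iff `x ∼_α y` for some `α < β`. -/
noncomputable def condensation (α : Ordinal.{u}) : L → L → Prop :=
  Ordinal.limitRecOn (motive := fun _ => L → L → Prop) α
    (fun x y => x = y)
    (fun _ r x y => ((fun z => {w | r z w}) '' Set.uIcc x y).Finite)
    (fun β _ r x y => ∃ α, ∃ h : α < β, r α h x y)

theorem condensation_zero (x y : L) : condensation L 0 x y ↔ x = y := by
  simp only [condensation, Ordinal.limitRecOn_zero]

theorem condensation_add_one (α : Ordinal.{u}) (x y : L) :
    condensation L (α + 1) x y ↔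
      ((fun z => {w | condensation L α z w}) '' Set.uIcc x y).Finite := by
  simp only [condensation, Ordinal.limitRecOn_add_one]

theorem condensation_limit (β : Ordinal.{u}) (hβ : Order.IsSuccLimit β) (x y : L) :
    condensation L β x y ↔ ∃ α < β, condensation L α x y := by
  unfold condensation
  rw [Ordinal.limitRecOn_limit _ _ _ _ hβ]
  simp only [exists_prop]

/-- Each `∼_α` is an equivalence relation with convex classes, and `∼_β` refines `∼_α` for
`β ≤ α`. -/
theorem condensation_aux (α : Ordinal.{u}) :
    Equivalence (condensation L α) ∧
      (∀ x y, condensation L α x y → ∀ z ∈ Set.uIcc x y, condensation L α x z) ∧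
      (∀ β ≤ α, ∀ x y, condensation L β x y → condensation L α x y) := by
  induction α using Ordinal.limitRecOn with
  | zero =>
    have h0 : condensation L 0 = Eq := by
      funext x y; exact propext (condensation_zero L x y)
    refine ⟨h0 ▸ eq_equivalence, ?_, ?_⟩
    · intro x y h z hz
      rw [condensation_zero] at h ⊢
      subst h
      simpa [eq_comm] using hz
    · intro β hβ x y h
      obtain rfl : β = 0 := le_antisymm hβ (by simp)
      exact h
  | add_one α ih =>
    obtain ⟨he, hc, hm⟩ := ih
    refine ⟨⟨fun x => ?_, fun {x y} h => ?_, fun {x y z} h h' => ?_⟩, ?_, ?_⟩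
    · rw [condensation_add_one]; simp
    · rw [condensation_add_one] at h ⊢
      rwa [Set.uIcc_comm]
    · rw [condensation_add_one] at h h' ⊢
      refine (h.union h').subset ?_
      rw [← Set.image_union]
      exact Set.image_mono Set.uIcc_subset_uIcc_union_uIcc
    · intro x y h z hz
      rw [condensation_add_one] at h ⊢
      exact h.subset (Set.image_mono (Set.uIcc_subset_uIcc_left hz))
    · intro β hβ x y h
      rcases hβ.lt_or_eq with hlt | rfl
      · have h1 := hm β (Order.lt_add_one_iff.mp hlt) x y h
        rw [condensation_add_one]
        refine (Set.finite_singleton {w | condensation L α x w}).subset ?_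
        rintro _ ⟨z, hz, rfl⟩
        have hxz := hc x y h1 z hz
        ext w
        exact ⟨fun hw => he.trans hxz hw, fun hw => he.trans (he.symm hxz) hw⟩
      · exact h
  | limit β hβ ih =>
    have hpos : (0 : Ordinal.{u}) < β := by simpa using hβ.bot_lt
    refine ⟨⟨fun x => ?_, fun {x y} h => ?_, fun {x y z} h h' => ?_⟩, ?_, ?_⟩
    · rw [condensation_limit L β hβ]
      exact ⟨0, hpos, (condensation_zero L x x).2 rfl⟩
    · rw [condensation_limit L β hβ] at h ⊢
      obtain ⟨γ, hγ, h⟩ := h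
      exact ⟨γ, hγ, (ih γ hγ).1.symm h⟩
    · rw [condensation_limit L β hβ] at h h' ⊢
      obtain ⟨γ, hγ, h⟩ := h
      obtain ⟨γ', hγ', h'⟩ := h'
      have hmax : max γ γ' < β := max_lt hγ hγ'
      exact ⟨max γ γ', hmax, (ih _ hmax).1.trans ((ih _ hmax).2.2 γ (le_max_left _ _) _ _ h)
        ((ih _ hmax).2.2 γ' (le_max_right _ _) _ _ h')⟩
    · intro x y h z hz
      rw [condensation_limit L β hβ] at h ⊢
      obtain ⟨γ, hγ, h⟩ := h
      exact ⟨γ, hγ, (ih γ hγ).2.1 x y h z hz⟩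
    · intro γ hγ x y h
      rcases hγ.lt_or_eq with hlt | rfl
      · rw [condensation_limit L β hβ]
        exact ⟨γ, hlt, h⟩
      · exact h

/-- The condensation `∼_α` as an equivalence relation; `Quotient (condensationSetoid L α)` is the
underlying set of `L/∼_α`. -/
noncomputable def condensationSetoid (α : Ordinal.{u}) : Setoid L :=
  ⟨condensation L α, (condensation_aux L α).1⟩

/-- `FC_*(L)`: the least ordinal `α` such that `L/∼_α` is finite. -/
noncomputable def FCstar : Ordinal.{u} :=
  sInf {α : Ordinal.{u} | Finite (Quotient (condensationSetoid L α))}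

/-- For a scattered order some `L/∼_α` is finite, so `FCstar` is a genuine minimum. -/
theorem IsScattered.exists_finite_quotient (hL : IsScattered L) :
    ∃ α : Ordinal.{u}, Finite (Quotient (condensationSetoid L α)) := by
  obtain ⟨α, hα⟩ : ∃ α : Ordinal.{u}, ∀ x y,
      condensation L (α + 1) x y → condensation L α x y := by
    have hni := not_injective_of_ordinal
      (fun α : Ordinal.{u} => {p : L × L | condensation L α p.1 p.2})
    simp only [Function.Injective, not_forall] at hni
    obtain ⟨a, b, hab, hne⟩ := hni
    have key : ∀ a b : Ordinal.{u}, a < b →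
        {p : L × L | condensation L a p.1 p.2} = {p : L × L | condensation L b p.1 p.2} →
        ∀ x y, condensation L (a + 1) x y → condensation L a x y := by
      intro a b hlt hab x y h
      have h2 := (condensation_aux L b).2.2 (a + 1) (Order.add_one_le_of_lt hlt) x y h
      have h3 : (x, y) ∈ {p : L × L | condensation L b p.1 p.2} := h2
      rw [← hab] at h3
      exact h3
    rcases lt_or_gt_of_ne hne with h | h
    · exact ⟨a, key a b h hab⟩
    · exact ⟨b, key b a h hab.symm⟩
  obtain ⟨he, hc, -⟩ := condensation_aux L α
  refine ⟨α, ?_⟩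
  by_contra hinf
  let Q := Quotient (condensationSetoid L α)
  let S : Set L := Set.range (Quotient.out : Q → L)
  have hS : ∀ s ∈ S, ∀ t ∈ S, condensation L α s t → s = t := by
    rintro _ ⟨p, rfl⟩ _ ⟨q, rfl⟩ h
    have : p = q := Quotient.out_equiv_out.1 h
    rw [this]
  have hrep : ∀ z, ∃ s ∈ S, condensation L α s z := fun z =>
    ⟨(Quotient.mk (condensationSetoid L α) z).out, ⟨_, rfl⟩,
      Quotient.mk_out (s := condensationSetoid L α) z⟩
  have : Nontrivial S := by
    rw [Set.nontrivial_coe_sort]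
    by_contra h
    rw [Set.not_nontrivial_iff] at h
    refine hinf (@Finite.of_subsingleton Q ⟨fun p q => ?_⟩)
    exact Quotient.out_injective (h ⟨p, rfl⟩ ⟨q, rfl⟩)
  have : DenselyOrdered S := by
    refine ⟨fun ⟨s, hs⟩ ⟨t, ht⟩ hst => ?_⟩
    have hst' : s < t := hst
    have hne : ¬ condensation L α s t := fun h => hst'.ne (hS s hs t ht h)
    have hne' : ¬ condensation L (α + 1) s t := fun h => hne (hα s t h)
    obtain ⟨z, hz, hsz, hzt⟩ : ∃ z ∈ Set.uIcc s t,
        ¬ condensation L α s z ∧ ¬ condensation L α z t := by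
      by_contra hcon
      push Not at hcon
      apply hne'
      rw [condensation_add_one]
      refine (Set.toFinite {{w | condensation L α s w}, {w | condensation L α t w}}).subset ?_
      rintro _ ⟨z, hz, rfl⟩
      by_cases hsz : condensation L α s z
      · left
        ext w
        exact ⟨fun hw => he.trans hsz hw, fun hw => he.trans (he.symm hsz) hw⟩
      · right
        have hzt := hcon z hz hsz
        ext w
        exact ⟨fun hw => he.trans (he.symm hzt) hw, fun hw => he.trans hzt hw⟩
    rw [Set.uIcc_of_le hst'.le] at hz
    obtain ⟨r, hr, hrz⟩ := hrep z
    refine ⟨⟨r, hr⟩, ?_, ?_⟩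
    · change s < r
      by_contra hle
      have hle := not_lt.1 hle
      have := hc r z hrz s (by rw [Set.uIcc_of_le (hle.trans hz.1)]; exact ⟨hle, hz.1⟩)
      exact hsz (he.trans (he.symm this) hrz)
    · change r < t
      by_contra hle
      have hle := not_lt.1 hle
      have := hc r z hrz t (by rw [Set.uIcc_of_ge (hz.2.trans hle)]; exact ⟨hz.2, hle⟩)
      exact hzt (he.trans (he.symm hrz) this)
  obtain ⟨f⟩ := Order.embedding_from_countable_to_dense ℚ S
  exact hL.false (f.trans (OrderEmbedding.subtype (· ∈ S)))

end Condensation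

/-! ## Automata on words indexed by a linear order -/

/-- The cuts `(C, D)` of `L`, given by their downward closed part `C` and ordered by inclusion.
The cut `(∅, L)` is `⊥` and `(L, ∅)` is `⊤`; the consecutive cuts around `l` are
`LowerSet.Iio l` and `LowerSet.Iic l`. -/
abbrev Cuts (L : Type u) [LinearOrder L] : Type u := LowerSet L

/-- The set of values that `r` takes at cuts arbitrarily close to `c` from below. -/
def limBelow {L : Type u} [LinearOrder L] {Q : Type v} (r : Cuts L → Q) (c : Cuts L) : Set Q :=
  {q | ∀ d < c, ∃ e, d ≤ e ∧ e < c ∧ r e = q}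

/-- The set of values that `r` takes at cuts arbitrarily close to `c` from above. -/
def limAbove {L : Type u} [LinearOrder L] {Q : Type v} (r : Cuts L → Q) (c : Cuts L) : Set Q :=
  {q | ∀ d, c < d → ∃ e, c < e ∧ e ≤ d ∧ r e = q}

/-- An automaton for words over the alphabet `S` with state set `Q` (both are taken to be finite
wherever automata are used). The transition relation is split into successor transitions in
`Q × S × Q`, right limit transitions in `2^Q × Q` and left limit transitions in `Q × 2^Q`. -/
structure Automaton (S : Type) (Q : Type) where
  /-- the initial states -/
  init : Set Q
  /-- the final states -/
  final : Set Q
  /-- the successor transitions -/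
  succTrans : Set (Q × S × Q)
  /-- the right limit transitions -/
  rightLimTrans : Set (Set Q × Q)
  /-- the left limit transitions -/
  leftLimTrans : Set (Q × Set Q)

namespace Automaton

variable {S Q : Type} {L : Type u} [LinearOrder L]

/-- `r` is a run of the automaton on the word `w`. -/
structure IsRun (M : Automaton S Q) (w : L → S) (r : Cuts L → Q) : Prop where
  succ : ∀ l : L, (r (LowerSet.Iio l), w l, r (LowerSet.Iic l)) ∈ M.succTrans
  rightLim : ∀ c : Cuts L, c ≠ ⊥ → (¬ ∃ d, d ⋖ c) → (limBelow r c, r c) ∈ M.rightLimTrans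
  leftLim : ∀ c : Cuts L, c ≠ ⊤ → (¬ ∃ d, c ⋖ d) → (r c, limAbove r c) ∈ M.leftLimTrans

/-- The automaton accepts the word `w`: there is a run on `w` that starts in an initial state and
ends in a final state. -/
def Accepts (M : Automaton S Q) (w : L → S) : Prop :=
  ∃ r : Cuts L → Q, M.IsRun w r ∧ r ⊥ ∈ M.init ∧ r ⊤ ∈ M.final

end Automaton

/-- The convolution of two `L`-words. -/
def conv {L : Type u} {S T : Type} (w : L → S) (v : L → T) : L → S × T :=
  fun l => (w l, v l)

/-- An `L`-word is finite if it differs from the blank symbol at finitely many positions only. -/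
def IsFiniteWord {L : Type u} {S : Type} (blank : S) (w : L → S) : Prop :=
  {l | w l ≠ blank}.Finite

/-- `(A, R)` is finite word `L`-`o`-automatic for the oracle `o`, up to isomorphism: there is a
finite alphabet `S` with a blank symbol, a bijection `f` of `A` with a set of finite `L`-words over
`S` and finite automata which, reading words convoluted with `o`, recognise exactly this set of
words and exactly the image of `R`. -/
def IsFiniteWordAutomaticWithOracle (L : Type u) [LinearOrder L] {T : Type} (o : L → T)
    (A : Type v) (R : A → A → Prop) : Prop :=
  ∃ (S : Type) (_ : Finite S) (blank : S) (f : A → L → S)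
    (Q₁ : Type) (_ : Finite Q₁) (M : Automaton (S × T) Q₁)
    (Q₂ : Type) (_ : Finite Q₂) (N : Automaton (S × S × T) Q₂),
    Function.Injective f ∧
    (∀ a, IsFiniteWord blank (f a)) ∧
    (∀ w : L → S, M.Accepts (conv w o) ↔ ∃ a, f a = w) ∧
    (∀ w v : L → S, N.Accepts (conv w (conv v o)) ↔ ∃ a b, f a = w ∧ f b = v ∧ R a b)

/-- `(A, R)` is finite word `L`-oracle-automatic: it is finite word `L`-`o`-automatic for some
`L`-word `o` over some finite alphabet. -/
def IsFiniteWordOracleAutomatic (L : Type u) [LinearOrder L] (A : Type v) (R : A → A → Prop) :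
    Prop :=
  ∃ (T : Type) (_ : Finite T) (o : L → T), IsFiniteWordAutomaticWithOracle L o A R

/-- A linear order `(A, ≤)` is finite word `L`-oracle-automatic. -/
def IsFiniteWordOracleAutomaticOrder (L : Type u) [LinearOrder L] (A : Type v) [LinearOrder A] :
    Prop :=
  IsFiniteWordOracleAutomatic L A (fun a b => a ≤ b)

end ScatteredAutomatic

namespace ScatteredAutomatic

open Set Ordinal

/-! ### A strictly monotone sum of ordinals -/

/-! Ranks are measured by `HasRank`, which passes to arbitrary subsets, strictly monotone images and
finite unions. On convex sets it says exactly that only finitely many `∼_γ`-classes are met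
(`FinClasses.hasRank`, `HasRank.finClasses`), so bounding it for the whole order bounds `FCstar`.

Runs compose: the state pairs joined by a run across an interval of cuts are determined by those of
its two halves, and the type over all of `L` decides the order. When the positions split into `I`
and `J`, a presented order is therefore a finite union of cells, each a product of a set of words on
`I` and a set of words on `J`, with comparison depending only on finite colourings of pairs. The
rank of such a tame product is at most the natural sum of the ranks of its factors
(`IsTameProduct.hasRank_image2`). Since `ω ^ α` is closed under natural sums, bounds of this form
survive splitting (`RankBound.of_split`).

The exponent grows in `RankBound.of_forall_split`. If ranks were not below `ω ^ (α + 1)`, there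
would be intervals of rank exactly `ω ^ α * (n + 1)` for every `n`. Take more of them than there are
finite codes and put the supports of their endpoints into `I`, whose bound is `ω ^ α`. The factor on
`I` is too small to account for the rank, so some factor on `J` must have rank between `ω ^ α * n`
and `ω ^ α * (n + 1)`. On `J` all endpoints are blank, so this factor is determined by a code from a
finite set that depends only on the typing; two different `n` share a code, which is absurd.

Finally, induct on `α` (`IsCompositional.rankBound`). Inside one `∼_(1+α)`-class any finite set of
positions is enclosed in closed intervals meeting finitely many `∼_γ`-classes for some `γ < 1 + α`,
to which the induction hypothesis applies. Finitely many classes are handled by splitting. -/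

/-- The natural (Hessenberg) sum: the least operation strictly monotone in both arguments. -/
noncomputable def nsum (a b : Ordinal.{u}) : Ordinal.{u} :=
  max (⨆ x : Iio a, Order.succ (nsum x.1 b)) (⨆ x : Iio b, Order.succ (nsum a x.1))
termination_by (a, b)
decreasing_by
  · exact Prod.Lex.left _ _ x.2
  · exact Prod.Lex.right _ x.2

theorem nsum_lt_nsum_right {a a' : Ordinal.{u}} (h : a' < a) (b : Ordinal.{u}) :
    nsum a' b < nsum a b := by
  conv_rhs => rw [nsum]
  refine lt_max_of_lt_left (Order.succ_le_iff.1 ?_)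
  exact le_ciSup (f := fun x : Iio a => Order.succ (nsum x.1 b)) bddAbove_of_small ⟨a', h⟩

theorem nsum_lt_nsum_left (a : Ordinal.{u}) {b b' : Ordinal.{u}} (h : b' < b) :
    nsum a b' < nsum a b := by
  conv_rhs => rw [nsum]
  refine lt_max_of_lt_right (Order.succ_le_iff.1 ?_)
  exact le_ciSup (f := fun x : Iio b => Order.succ (nsum a x.1)) bddAbove_of_small ⟨b', h⟩

theorem nsum_le {a b c : Ordinal.{u}} (h₁ : ∀ x < a, nsum x b < c) (h₂ : ∀ x < b, nsum a x < c) :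
    nsum a b ≤ c := by
  rw [nsum]
  refine max_le (Ordinal.iSup_le fun x => ?_) (Ordinal.iSup_le fun x => ?_)
  · exact Order.succ_le_of_lt (h₁ x.1 x.2)
  · exact Order.succ_le_of_lt (h₂ x.1 x.2)

theorem le_nsum_left (a b : Ordinal.{u}) : a ≤ nsum a b :=
  (show StrictMono (fun a => nsum a b) from fun _ _ h => nsum_lt_nsum_right h b).le_apply

theorem le_nsum_right (a b : Ordinal.{u}) : b ≤ nsum a b :=
  (show StrictMono (nsum a) from fun _ _ h => nsum_lt_nsum_left a h).le_apply

theorem exists_nat_lt_of_lt_opow_mul {γ x : Ordinal.{u}} {n : ℕ} (h : x < ω ^ γ * n) :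
    ∃ j : ℕ, j < n ∧ ∃ y < ω ^ γ, x = ω ^ γ * j + y := by
  have hpos : ω ^ γ ≠ 0 := (opow_pos γ omega0_pos).ne'
  have hd : x / ω ^ γ < n := (lt_mul_iff_div_lt hpos).1 h
  obtain ⟨j, hj⟩ := lt_omega0.1 (hd.trans (natCast_lt_omega0 n))
  refine ⟨j, ?_, x % ω ^ γ, mod_lt x hpos, ?_⟩
  · rw [hj] at hd
    exact_mod_cast hd
  · rw [← hj, div_add_mod]

theorem opow_mul_add_lt {γ y : Ordinal.{u}} {j k : ℕ} (hy : y < ω ^ γ) (h : j < k) :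
    ω ^ γ * j + y < ω ^ γ * k := by
  calc ω ^ γ * j + y < ω ^ γ * j + ω ^ γ := by gcongr
    _ = ω ^ γ * ((j + 1 : ℕ) : Ordinal.{u}) := by push_cast; rw [mul_add_one]
    _ ≤ ω ^ γ * k := by gcongr; exact_mod_cast h

/-- Leading coefficients add. Lowering an argument lowers either its coefficient, where closure of
`ω ^ γ` absorbs the remainders, or its remainder, where strict monotonicity of `nsum` applies. -/
theorem nsum_opow_mul_add_le {γ : Ordinal.{u}}
    (hγ : ∀ a < ω ^ γ, ∀ b < ω ^ γ, nsum a b < ω ^ γ) (a b : Ordinal.{u}) :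
    ∀ (j k : ℕ), ∀ x < ω ^ γ, ∀ y < ω ^ γ, a = ω ^ γ * j + x → b = ω ^ γ * k + y →
      nsum a b ≤ ω ^ γ * ((j + k : ℕ) : Ordinal.{u}) + nsum x y := by
  induction a using WellFoundedLT.induction generalizing b with
  | ind a iha =>
  induction b using WellFoundedLT.induction with
  | ind b ihb =>
  intro j k x hx y hy ha hb
  refine nsum_le (fun c hc => ?_) (fun c hc => ?_)
  · obtain ⟨i, hi, z, hz, rfl⟩ := exists_nat_lt_of_lt_opow_mul
      (hc.trans (ha.trans_lt (opow_mul_add_lt hx j.lt_succ_self)))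
    refine (iha _ hc b i k z hz y hy rfl hb).trans_lt ?_
    rcases (Nat.lt_succ_iff.1 hi).lt_or_eq with h | rfl
    · exact (opow_mul_add_lt (hγ z hz y hy) (by omega)).trans_le le_self_add
    · rw [ha] at hc
      gcongr
      exact nsum_lt_nsum_right (lt_of_add_lt_add_left hc) y
  · obtain ⟨i, hi, z, hz, rfl⟩ := exists_nat_lt_of_lt_opow_mul
      (hc.trans (hb.trans_lt (opow_mul_add_lt hy k.lt_succ_self)))
    refine (ihb _ hc j i x hx z hz ha rfl).trans_lt ?_
    rcases (Nat.lt_succ_iff.1 hi).lt_or_eq with h | rfl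
    · exact (opow_mul_add_lt (hγ x hx z hz) (by omega)).trans_le le_self_add
    · rw [hb] at hc
      gcongr
      exact nsum_lt_nsum_left x (lt_of_add_lt_add_left hc)

/-- At a successor exponent both arguments lie below finite multiples of the previous power, and so
does their sum; at a limit both lie below a common earlier power. -/
theorem nsum_lt_opow (γ : Ordinal.{u}) : ∀ a < ω ^ γ, ∀ b < ω ^ γ, nsum a b < ω ^ γ := by
  induction γ using Ordinal.limitRecOn with
  | zero =>
    intro a ha b hb
    rw [opow_zero, Order.lt_one_iff] at *
    subst ha hb
    exact le_antisymm (nsum_le (by simp) (by simp)) (by simp)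
  | add_one γ ih =>
    intro a ha b hb
    rw [← Order.succ_eq_add_one] at ha hb ⊢
    obtain ⟨j, hj⟩ := (lt_omega0_opow_succ).1 ha
    obtain ⟨k, hk⟩ := (lt_omega0_opow_succ).1 hb
    obtain ⟨j, -, x, hx, hax⟩ := exists_nat_lt_of_lt_opow_mul hj
    obtain ⟨k, -, y, hy, hby⟩ := exists_nat_lt_of_lt_opow_mul hk
    refine lt_omega0_opow_succ.2 ⟨j + k + 1, ?_⟩
    exact (nsum_opow_mul_add_le ih a b j k x hx y hy hax hby).trans_lt
      (opow_mul_add_lt (ih x hx y hy) (Nat.lt_succ_self _))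
  | limit γ hγ ih =>
    intro a ha b hb
    obtain ⟨c, hc, hac⟩ := (lt_opow_of_isSuccLimit omega0_ne_zero hγ).1 ha
    obtain ⟨d, hd, hbd⟩ := (lt_opow_of_isSuccLimit omega0_ne_zero hγ).1 hb
    have hm : ω ^ max c d ≤ ω ^ γ := opow_le_opow_right omega0_pos (max_le hc.le hd.le)
    exact (ih _ (max_lt hc hd) a (hac.trans_le (opow_le_opow_right omega0_pos (le_max_left _ _))) b
      (hbd.trans_le (opow_le_opow_right omega0_pos (le_max_right _ _)))).trans_le hm

/-- For `a < ω ^ γ` the sum of `a` and `ω ^ γ * n` stays below `ω ^ γ * (n + 1)`. -/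
theorem nsum_lt_opow_mul {γ a : Ordinal.{u}} (ha : a < ω ^ γ) (n : ℕ) :
    nsum a (ω ^ γ * n) < ω ^ γ * ((n + 1 : ℕ) : Ordinal.{u}) := by
  have h0 : (0 : Ordinal.{u}) < ω ^ γ := opow_pos γ omega0_pos
  have := nsum_opow_mul_add_le (nsum_lt_opow γ) a (ω ^ γ * n) 0 n a ha 0 h0 (by simp) (by simp)
  exact this.trans_lt (opow_mul_add_lt (nsum_lt_opow γ a ha 0 h0) (by omega))

end ScatteredAutomatic

namespace ScatteredAutomatic

open Set Ordinal

/-! ### A Hausdorff rank for subsets of linear orders -/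

section Rank

variable {B : Type u} [LinearOrder B] {B' : Type u} [LinearOrder B']

/-- `HasRank γ S`: the set `S` is a finite union of sets `C` such that `C ∩ [x, y]` has rank
smaller than `γ` for all `x < y` in `C`. -/
inductive HasRank : Ordinal.{u} → Set B → Prop
  | base (γ : Ordinal.{u}) (S : Set B) (g : B → B → Ordinal.{u})
      (hlt : ∀ x y, x ∈ S → y ∈ S → x < y → g x y < γ)
      (h : ∀ x y, x ∈ S → y ∈ S → x < y → HasRank (g x y) (S ∩ Icc x y)) : HasRank γ S
  | union (γ : Ordinal.{u}) (S T : Set B) (hS : HasRank γ S) (hT : HasRank γ T) :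
      HasRank γ (S ∪ T)

theorem HasRank.of_forall_lt {γ : Ordinal.{u}} {S : Set B}
    (h : ∀ x ∈ S, ∀ y ∈ S, x < y → ∃ δ < γ, HasRank δ (S ∩ Icc x y)) : HasRank γ S := by
  classical
  choose! g hg hr using h
  exact .base γ S g (fun x y hx hy hxy => hg x hx y hy hxy) fun x y hx hy hxy => hr x hx y hy hxy

theorem HasRank.of_subsingleton {S : Set B} (hS : S.Subsingleton) (γ : Ordinal.{u}) :
    HasRank γ S :=
  .of_forall_lt fun _ hx _ hy hxy => absurd (hS hx hy) hxy.ne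

theorem HasRank.mono_rank {γ δ : Ordinal.{u}} {S : Set B} (h : HasRank γ S) (hγ : γ ≤ δ) :
    HasRank δ S := by
  induction h generalizing δ with
  | base γ S g hlt h _ =>
    exact .base δ S g (fun x y hx hy hxy => (hlt x y hx hy hxy).trans_le hγ) h
  | union γ S T _ _ ihS ihT => exact .union _ _ _ (ihS hγ) (ihT hγ)

/-- Strictly monotone maps pull back ranks. -/
theorem HasRank.of_strictMonoOn {γ : Ordinal.{u}} {S' : Set B'} (h : HasRank γ S')
    {S : Set B} (e : B → B') (he : StrictMonoOn e S) (hm : MapsTo e S S') : HasRank γ S := by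
  induction h generalizing S with
  | base γ S' g hlt h ih =>
    refine .of_forall_lt fun x hx y hy hxy => ?_
    have hxy' := he hx hy hxy
    refine ⟨_, hlt _ _ (hm hx) (hm hy) hxy',
      ih _ _ (hm hx) (hm hy) hxy' (he.mono inter_subset_left) fun z hz => ⟨hm hz.1, ?_, ?_⟩⟩
    · exact he.monotoneOn hx hz.1 hz.2.1
    · exact he.monotoneOn hz.1 hy hz.2.2
  | union γ S₁ S₂ _ _ ih₁ ih₂ =>
    have hS : S = (S ∩ e ⁻¹' S₁) ∪ (S ∩ e ⁻¹' S₂) := by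
      rw [← inter_union_distrib_left, ← preimage_union]
      exact (inter_eq_left.2 hm).symm
    rw [hS]
    exact .union _ _ _ (ih₁ (he.mono inter_subset_left) fun z hz => hz.2)
      (ih₂ (he.mono inter_subset_left) fun z hz => hz.2)

theorem HasRank.subset {γ : Ordinal.{u}} {S T : Set B} (h : HasRank γ S) (hT : T ⊆ S) :
    HasRank γ T :=
  h.of_strictMonoOn id strictMonoOn_id hT

theorem HasRank.image {γ : Ordinal.{u}} {S : Set B} (h : HasRank γ S) {e : B → B'}
    (he : StrictMonoOn e S) : HasRank γ (e '' S) := by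
  classical
  rcases S.eq_empty_or_nonempty with rfl | ⟨b, -⟩
  · rw [image_empty]; exact .of_subsingleton subsingleton_empty γ
  have : Nonempty B := ⟨b⟩
  refine h.of_strictMonoOn (Function.invFunOn e S) ?_ ?_
  · rintro _ ⟨x, hx, rfl⟩ _ ⟨y, hy, rfl⟩ hxy
    rw [he.injOn.leftInvOn_invFunOn hx, he.injOn.leftInvOn_invFunOn hy]
    exact (he.lt_iff_lt hx hy).1 hxy
  · rintro _ ⟨x, hx, rfl⟩
    rwa [he.injOn.leftInvOn_invFunOn hx]

theorem HasRank.iUnion {ι : Type*} [Finite ι] {γ : Ordinal.{u}} {C : ι → Set B}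
    (h : ∀ i, HasRank γ (C i)) : HasRank γ (⋃ i, C i) := by
  have key : ∀ s : Set ι, s.Finite → HasRank γ (⋃ i ∈ s, C i) := by
    intro s hs
    induction s, hs using Set.Finite.induction_on with
    | empty => simpa using HasRank.of_subsingleton subsingleton_empty γ
    | @insert a s _ _ ih =>
      rw [biUnion_insert]
      exact .union _ _ _ (h a) ih
  have := key univ finite_univ
  rwa [biUnion_univ] at this

/-- Sets of smaller rank than a positive ordinal are closed under finite unions. -/
theorem exists_hasRank_iUnion {ι : Type*} [Finite ι] {γ : Ordinal.{u}} (hγ : γ ≠ 0)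
    {C : ι → Set B} (h : ∀ i, ∃ δ < γ, HasRank δ (C i)) : ∃ δ < γ, HasRank δ (⋃ i, C i) := by
  choose g hg hr using h
  cases isEmpty_or_nonempty ι
  · exact ⟨0, pos_iff_ne_zero.2 hγ, .iUnion fun i => isEmptyElim i⟩
  obtain ⟨i, hi⟩ := Finite.exists_max g
  exact ⟨g i, hg i, .iUnion fun j => (hr j).mono_rank (hi j)⟩

theorem exists_hasRank_union {γ : Ordinal.{u}} {C D : Set B}
    (hC : ∃ δ < γ, HasRank δ C) (hD : ∃ δ < γ, HasRank δ D) : ∃ δ < γ, HasRank δ (C ∪ D) := by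
  obtain ⟨c, hc, hC⟩ := hC
  obtain ⟨d, hd, hD⟩ := hD
  exact ⟨max c d, max_lt hc hd, .union _ _ _ (hC.mono_rank (le_max_left _ _))
    (hD.mono_rank (le_max_right _ _))⟩

/-- Flattens the nested unions of the inductive definition into one finite family, ready for
pigeonhole arguments. -/
theorem HasRank.exists_cover {γ : Ordinal.{u}} {S : Set B} (h : HasRank γ S) :
    ∃ (n : ℕ) (C : Fin n → Set B), S ⊆ ⋃ i, C i ∧
      ∀ i, ∀ x ∈ C i, ∀ y ∈ C i, x < y → ∃ δ < γ, HasRank δ (C i ∩ Icc x y) := by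
  induction h with
  | base γ S g hlt h _ =>
    refine ⟨1, fun _ => S, fun x hx => mem_iUnion.2 ⟨0, hx⟩, fun _ x hx y hy hxy =>
      ⟨_, hlt x y hx hy hxy, h x y hx hy hxy⟩⟩
  | union γ S T _ _ ihS ihT =>
    obtain ⟨m, C, hC, hC'⟩ := ihS
    obtain ⟨n, D, hD, hD'⟩ := ihT
    refine ⟨m + n, Fin.append C D, ?_, fun i => ?_⟩
    · rintro x (hx | hx)
      · obtain ⟨i, hi⟩ := mem_iUnion.1 (hC hx)
        exact mem_iUnion.2 ⟨Fin.castAdd n i, by rwa [Fin.append_left]⟩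
      · obtain ⟨i, hi⟩ := mem_iUnion.1 (hD hx)
        exact mem_iUnion.2 ⟨Fin.natAdd m i, by rwa [Fin.append_right]⟩
    · induction i using Fin.addCases with
      | left i => rw [Fin.append_left]; exact hC' i
      | right i => rw [Fin.append_right]; exact hD' i

end Rank

/-! ### Comparison with the finite condensation -/

section Condensation

variable {B : Type u} [LinearOrder B]

/-- The set `S` meets only finitely many classes of the `γ`-th condensation. -/
def FinClasses (γ : Ordinal.{u}) (S : Set B) : Prop :=
  ((fun z => {w | condensation B γ z w}) '' S).Finite

theorem FinClasses.subset {γ : Ordinal.{u}} {S T : Set B} (h : FinClasses γ S) (hT : T ⊆ S) :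
    FinClasses γ T :=
  Set.Finite.subset h (image_mono hT)

theorem setOf_condensation_eq_iff {γ : Ordinal.{u}} {x y : B} :
    {w | condensation B γ x w} = {w | condensation B γ y w} ↔ condensation B γ x y := by
  have he := (condensation_aux B γ).1
  constructor
  · intro h
    have : y ∈ {w | condensation B γ y w} := he.refl y
    rwa [← h] at this
  · intro h
    ext w
    exact ⟨fun hw => he.trans (he.symm h) hw, fun hw => he.trans h hw⟩

theorem condensation_mono {γ δ : Ordinal.{u}} (h : γ ≤ δ) {x y : B} (hxy : condensation B γ x y) :
    condensation B δ x y :=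
  (condensation_aux B δ).2.2 γ h x y hxy

theorem FinClasses.mono {γ δ : Ordinal.{u}} {S : Set B} (h : FinClasses γ S) (hγ : γ ≤ δ) :
    FinClasses δ S := by
  refine (Set.Finite.image (fun C => {w | ∃ z ∈ C, condensation B δ z w}) h).subset ?_
  rintro _ ⟨x, hx, rfl⟩
  refine ⟨_, ⟨x, hx, rfl⟩, ?_⟩
  ext w
  constructor
  · rintro ⟨z, hz, hzw⟩
    exact (condensation_aux B δ).1.trans (condensation_mono hγ hz) hzw
  · intro hw
    exact ⟨x, (condensation_aux B γ).1.refl x, hw⟩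

/-- A uniform description of the condensations. -/
theorem condensation_iff (γ : Ordinal.{u}) (x y : B) :
    condensation B γ x y ↔ x = y ∨ ∃ δ < γ, FinClasses δ (uIcc x y) := by
  induction γ using Ordinal.limitRecOn with
  | zero => simp [condensation_zero]
  | add_one γ ih =>
    rw [condensation_add_one]
    constructor
    · exact fun h => .inr ⟨γ, Order.lt_add_one_iff.2 le_rfl, h⟩
    · rintro (rfl | ⟨δ, hδ, h⟩)
      · simp
      · exact FinClasses.mono h (Order.lt_add_one_iff.1 hδ)
  | limit γ hγ ih =>
    rw [condensation_limit B γ hγ]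
    constructor
    · rintro ⟨δ, hδ, h⟩
      rcases (ih δ hδ).1 h with h | ⟨ε, hε, h⟩
      · exact .inl h
      · exact .inr ⟨ε, hε.trans hδ, h⟩
    · rintro (rfl | ⟨δ, hδ, h⟩)
      · exact ⟨0, hγ.bot_lt, (condensation_zero B x x).2 rfl⟩
      · exact ⟨δ + 1, hγ.add_one_lt hδ, (condensation_add_one B δ x y).2 h⟩

/-- The classes themselves serve as pieces: two points of one class span an interval that is finite
modulo an earlier condensation. -/
theorem FinClasses.hasRank {γ : Ordinal.{u}} {S : Set B} (h : FinClasses γ S) : HasRank γ S := by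
  induction γ using WellFoundedLT.induction generalizing S with
  | ind γ ih =>
  have : Finite ((fun z => {w | condensation B γ z w}) '' S) := h
  have hS : S ⊆ ⋃ C : (fun z => {w | condensation B γ z w}) '' S, C.1 := fun x hx =>
    mem_iUnion.2 ⟨⟨_, x, hx, rfl⟩, (condensation_aux B γ).1.refl x⟩
  refine (HasRank.iUnion fun C => ?_).subset hS
  obtain ⟨_, z, hz, rfl⟩ := C
  refine .of_forall_lt fun x hx y hy hxy => ?_
  have he := (condensation_aux B γ).1
  rcases (condensation_iff γ x y).1 (he.trans (he.symm hx) hy) with h | ⟨δ, hδ, h⟩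
  · exact absurd h hxy.ne
  · refine ⟨δ, hδ, (ih δ hδ h).subset ?_⟩
    rw [uIcc_of_le hxy.le]
    exact inter_subset_right

/-- Among many inequivalent points, some two consecutive ones span an interval that every piece
meeting it covers from end to end. That interval then has rank below `γ`, so by induction its
endpoints are equivalent after all. -/
theorem HasRank.finClasses {γ : Ordinal.{u}} {S : Set B} (h : HasRank γ S) (hS : S.OrdConnected) :
    FinClasses γ S := by
  induction γ using WellFoundedLT.induction generalizing S with
  | ind γ ih =>
  by_contra hinf
  obtain ⟨n, C, hSC, hC⟩ := h.exists_cover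
  -- a long increasing sequence of inequivalent points of `S`
  obtain ⟨D, hDS, hDinf, hD⟩ : ∃ D ⊆ S, D.Infinite ∧
      ∀ x ∈ D, ∀ y ∈ D, condensation B γ x y → x = y := by
    obtain ⟨D, hDS, hD⟩ := SurjOn.exists_bijOn_subset
      (surjOn_image (fun z => {w | condensation B γ z w}) S)
    refine ⟨D, hDS, fun hfin => hinf ?_, fun x hx y hy hxy =>
      hD.injOn hx hy (setOf_condensation_eq_iff.2 hxy)⟩
    have := hfin.image (fun z => {w | condensation B γ z w})
    rwa [hD.image_eq] at this
  -- These points bound `2n + 1` consecutive intervals, one more than the `2n` ends of the `n`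
  -- pieces.
  obtain ⟨s, hsD, hs⟩ := hDinf.exists_subset_card_eq (n * 2 + 2)
  let x := s.orderEmbOfFin hs
  have hx : ∀ i, x i ∈ D := fun i => hsD (s.orderEmbOfFin_mem hs i)
  -- The piece meets the `j`-th interval but fails to reach its left endpoint (second index `0`) or
  -- its right endpoint (second index `1`). Each pair can be bad for only one interval.
  let bad (j : Fin (n * 2 + 1)) (p : Fin n × Fin 2) : Prop :=
    (C p.1 ∩ Icc (x j.castSucc) (x j.succ)).Nonempty ∧
      ((p.2 = 0 ∧ ∀ z ∈ C p.1, x j.castSucc < z) ∨ (p.2 = 1 ∧ ∀ z ∈ C p.1, z < x j.succ))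
  have hbad : ∀ j j' p, bad j p → bad j' p → ¬ j < j' := by
    rintro j j' ⟨i, t⟩ ⟨⟨z, hz, hz'⟩, h⟩ ⟨⟨z', hz₁, hz₂⟩, h'⟩ hlt
    have hle : x j.succ ≤ x j'.castSucc := x.monotone (Fin.succ_le_castSucc_iff.2 hlt)
    rcases h with ⟨rfl, h⟩ | ⟨rfl, h⟩ <;> rcases h' with ⟨ht, h'⟩ | ⟨ht, h'⟩
    · exact absurd (h' z hz) (not_lt.2 (hz'.2.trans hle))
    · exact absurd ht (by simp)
    · exact absurd ht (by simp)
    · exact absurd (h z' hz₁) (not_lt.2 (hle.trans hz₂.1))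
  obtain ⟨j, hj⟩ : ∃ j, ∀ p, ¬ bad j p := by
    by_contra hcon
    push Not at hcon
    choose p hp using hcon
    obtain ⟨j, j', hne, heq⟩ := Fintype.exists_ne_map_eq_of_card_lt p (by simp)
    rcases lt_or_gt_of_ne hne with h | h
    · exact hbad _ _ _ (hp j) (heq ▸ hp j') h
    · exact hbad _ _ _ (hp j') (heq ▸ hp j) h
  have hlt : x j.castSucc < x j.succ := x.strictMono Fin.castSucc_lt_succ
  have hIS : Icc (x j.castSucc) (x j.succ) ⊆ S := hS.out (hDS (hx _)) (hDS (hx _))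
  have hpiece : ∀ i, (C i ∩ Icc (x j.castSucc) (x j.succ)).Nonempty →
      ∃ δ < γ, HasRank δ (C i ∩ Icc (x j.castSucc) (x j.succ)) := by
    intro i hi
    have h0 : ∃ z ∈ C i, z ≤ x j.castSucc := by
      by_contra hcon
      push Not at hcon
      exact hj (i, 0) ⟨hi, .inl ⟨rfl, hcon⟩⟩
    have h1 : ∃ z ∈ C i, x j.succ ≤ z := by
      by_contra hcon
      push Not at hcon
      exact hj (i, 1) ⟨hi, .inr ⟨rfl, hcon⟩⟩
    obtain ⟨u, hu, hu'⟩ := h0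
    obtain ⟨v, hv, hv'⟩ := h1
    obtain ⟨δ, hδ, h⟩ := hC i u hu v hv (hu'.trans_lt (hlt.trans_le hv'))
    exact ⟨δ, hδ, h.subset (inter_subset_inter_right _ (Icc_subset_Icc hu' hv'))⟩
  obtain ⟨δ, hδ, hr⟩ : ∃ δ < γ, HasRank δ (Icc (x j.castSucc) (x j.succ)) := by
    have hγ : γ ≠ 0 := by
      rintro rfl
      obtain ⟨i, hi⟩ := mem_iUnion.1 (hSC (hDS (hx j.castSucc)))
      obtain ⟨δ, hδ, -⟩ := hpiece i ⟨_, hi, le_rfl, hlt.le⟩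
      exact absurd hδ (by simp)
    obtain ⟨δ, hδ, h⟩ := exists_hasRank_iUnion hγ
      (C := fun i => C i ∩ Icc (x j.castSucc) (x j.succ)) fun i => by
        rcases (C i ∩ Icc (x j.castSucc) (x j.succ)).eq_empty_or_nonempty with h | h
        · rw [h]
          exact ⟨0, pos_iff_ne_zero.2 hγ, .of_subsingleton subsingleton_empty 0⟩
        · exact hpiece i h
    refine ⟨δ, hδ, h.subset fun z hz => ?_⟩
    obtain ⟨i, hi⟩ := mem_iUnion.1 (hSC (hIS hz))
    exact mem_iUnion.2 ⟨i, hi, hz⟩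
  refine hlt.ne (hD _ (hx _) _ (hx _) ((condensation_iff γ _ _).2 (.inr ⟨δ, hδ, ?_⟩)))
  rw [uIcc_of_le hlt.le]
  exact ih δ hδ hr ordConnected_Icc

theorem FinClasses.of_finite {γ : Ordinal.{u}} [Finite (Quotient (condensationSetoid B γ))]
    (S : Set B) : FinClasses γ S := by
  refine (Set.finite_range (fun q : Quotient (condensationSetoid B γ) =>
    {w | condensation B γ q.out w})).subset ?_
  rintro _ ⟨x, -, rfl⟩
  refine ⟨Quotient.mk _ x, setOf_condensation_eq_iff.2 ?_⟩
  exact Quotient.mk_out (s := condensationSetoid B γ) x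

theorem FinClasses.finite_quotient {γ : Ordinal.{u}} (h : FinClasses γ (univ : Set B)) :
    Finite (Quotient (condensationSetoid B γ)) := by
  have : Finite ((fun z => {w | condensation B γ z w}) '' univ) := h
  refine Finite.of_injective (β := (fun z => {w | condensation B γ z w}) '' univ)
    (fun q => ⟨_, q.out, mem_univ _, rfl⟩) fun p q hpq => ?_
  have := setOf_condensation_eq_iff.1 (Subtype.ext_iff.1 hpq)
  exact Quotient.out_equiv_out.1 this

/-- A scattered order without rank `γ` has a closed interval whose rank is exactly `γ`. -/
theorem IsScattered.exists_interval_rank (hB : IsScattered B) {γ : Ordinal.{u}}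
    (hγ : ¬ HasRank γ (univ : Set B)) :
    ∃ p q : B, p < q ∧ HasRank γ (Icc p q) ∧ ∀ δ < γ, ¬ HasRank δ (Icc p q) := by
  obtain ⟨x, y, hxy, hne⟩ : ∃ x y, condensation B (γ + 1) x y ∧ ¬ condensation B γ x y := by
    by_contra hcon
    push Not at hcon
    -- If nothing new is identified at stage `γ + 1`, the condensation is stable from `γ` on.
    -- Scatteredness gives a stage with finite quotient, so stage `γ` already has one, contradicting
    -- `hγ`.
    have key : ∀ δ x y, condensation B δ x y → condensation B γ x y := by
      intro δ
      induction δ using WellFoundedLT.induction with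
      | ind δ ih =>
      intro x y h
      rcases (condensation_iff δ x y).1 h with rfl | ⟨ε, hε, h⟩
      · exact (condensation_aux B γ).1.refl x
      · refine hcon x y ((condensation_add_one B γ x y).2 ?_)
        refine (Set.Finite.image (fun C => {w | ∃ z ∈ C, condensation B γ z w}) h).subset ?_
        rintro _ ⟨z, hz, rfl⟩
        refine ⟨_, ⟨z, hz, rfl⟩, ?_⟩
        ext w
        constructor
        · rintro ⟨t, ht, htw⟩
          exact (condensation_aux B γ).1.trans (ih ε hε _ _ ht) htw
        · intro hw
          exact ⟨z, (condensation_aux B ε).1.refl z, hw⟩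
    obtain ⟨δ, hδ⟩ := hB.exists_finite_quotient
    apply hγ
    have h1 : FinClasses δ (univ : Set B) := FinClasses.of_finite _
    refine FinClasses.hasRank
      ((Set.Finite.image (fun C => {w | ∃ z ∈ C, condensation B γ z w}) h1).subset ?_)
    rintro _ ⟨z, hz, rfl⟩
    refine ⟨_, ⟨z, hz, rfl⟩, ?_⟩
    ext w
    constructor
    · rintro ⟨t, ht, htw⟩
      exact (condensation_aux B γ).1.trans (key δ _ _ ht) htw
    · intro hw
      exact ⟨z, (condensation_aux B δ).1.refl z, hw⟩
  have main : ∀ x y : B, x < y → condensation B (γ + 1) x y → ¬ condensation B γ x y →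
      ∃ p q : B, p < q ∧ HasRank γ (Icc p q) ∧ ∀ δ < γ, ¬ HasRank δ (Icc p q) := by
    intro x y hlt hxy hne
    rw [condensation_add_one, uIcc_of_le hlt.le] at hxy
    refine ⟨x, y, hlt, FinClasses.hasRank hxy, fun δ hδ h => hne ?_⟩
    refine (condensation_iff γ x y).2 (.inr ⟨δ, hδ, ?_⟩)
    rw [uIcc_of_le hlt.le]
    exact h.finClasses ordConnected_Icc
  have hne' : x ≠ y := by
    rintro rfl
    exact hne ((condensation_aux B γ).1.refl x)
  rcases lt_or_gt_of_ne hne' with h | h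
  · exact main x y h hxy hne
  · exact main y x h ((condensation_aux B _).1.symm hxy)
      fun h => hne ((condensation_aux B γ).1.symm h)

end Condensation

end ScatteredAutomatic

namespace ScatteredAutomatic

open Set Ordinal Filter

/-! ### Ranks of tamely coloured products -/

section Product

variable {X Y Z : Type u} [LinearOrder X] [LinearOrder Y] [LinearOrder Z]

/-- `m : X → Y → Z` is strictly monotone in each argument, and the order of two values depends
only on finite colourings of the pairs of first and of second arguments. -/
structure IsTameProduct (m : X → Y → Z) : Prop where
  left : ∀ y, StrictMono fun x => m x y
  right : ∀ x, StrictMono (m x)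
  tame : ∃ (K : Type) (_ : Finite K) (χ : X → X → K) (ψ : Y → Y → K),
    ∀ x₁ x₁' x₂ x₂' y₁ y₁' y₂ y₂', χ x₁ x₁' = χ x₂ x₂' → ψ y₁ y₁' = ψ y₂ y₂' →
      (m x₁ y₁ ≤ m x₁' y₁' ↔ m x₂ y₂ ≤ m x₂' y₂')

theorem IsTameProduct.swap {m : X → Y → Z} (hm : IsTameProduct m) :
    IsTameProduct fun y x => m x y := by
  obtain ⟨K, hK, χ, ψ, h⟩ := hm.tame
  exact ⟨hm.right, hm.left, K, hK, ψ, χ, fun y₁ y₁' y₂ y₂' x₁ x₁' x₂ x₂' hy hx =>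
    h x₁ x₁' x₂ x₂' y₁ y₁' y₂ y₂' hx hy⟩

variable {m : X → Y → Z} {S : Set X} {T : Set Y} {η : Ordinal.{u}}

theorem IsTameProduct.le_or_le (hm : IsTameProduct m) {x x' : X} {y y' : Y}
    (h : m x y ≤ m x' y') : x ≤ x' ∨ y ≤ y' := by
  by_contra hcon
  push Not at hcon
  exact absurd h (not_le.2 ((hm.left y' hcon.1).trans (hm.right x hcon.2)))

/-- By `IsTameProduct.le_or_le`, everything below `m a b` lies in the slice with first coordinate at
most `a` or in the slice with second coordinate at most `b`; both have small rank. -/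
theorem IsTameProduct.hasRank_upper_upper (hm : IsTameProduct m)
    (hX : ∀ x ∈ S, ∀ x' ∈ S, ∃ ε < η, HasRank ε (image2 m (S ∩ Icc x x') T))
    (hY : ∀ y ∈ T, ∀ y' ∈ T, ∃ ε < η, HasRank ε (image2 m S (T ∩ Icc y y')))
    {x₀ : X} (hx₀ : x₀ ∈ S) {y₀ : Y} (hy₀ : y₀ ∈ T) :
    HasRank η (image2 m (S ∩ Ici x₀) (T ∩ Ici y₀)) := by
  refine .of_forall_lt ?_
  rintro z - _ ⟨a, ha, b, hb, rfl⟩ -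
  obtain ⟨ε, hε, h⟩ := exists_hasRank_union (hX x₀ hx₀ a ha.1) (hY y₀ hy₀ b hb.1)
  refine ⟨ε, hε, h.subset ?_⟩
  rintro _ ⟨⟨c, hc, d, hd, rfl⟩, -, hle⟩
  rcases hm.le_or_le hle with h | h
  · exact .inl ⟨c, ⟨hc.1, hc.2, h⟩, d, hd.1, rfl⟩
  · exact .inr ⟨c, hc.1, d, ⟨hd.1, hd.2, h⟩, rfl⟩

theorem IsTameProduct.hasRank_lower_lower (hm : IsTameProduct m)
    (hX : ∀ x ∈ S, ∀ x' ∈ S, ∃ ε < η, HasRank ε (image2 m (S ∩ Icc x x') T))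
    (hY : ∀ y ∈ T, ∀ y' ∈ T, ∃ ε < η, HasRank ε (image2 m S (T ∩ Icc y y')))
    {x₀ : X} (hx₀ : x₀ ∈ S) {y₀ : Y} (hy₀ : y₀ ∈ T) :
    HasRank η (image2 m (S ∩ Iic x₀) (T ∩ Iic y₀)) := by
  refine .of_forall_lt ?_
  rintro _ ⟨a, ha, b, hb, rfl⟩ z - -
  obtain ⟨ε, hε, h⟩ := exists_hasRank_union (hX a ha.1 x₀ hx₀) (hY b hb.1 y₀ hy₀)
  refine ⟨ε, hε, h.subset ?_⟩
  rintro _ ⟨⟨c, hc, d, hd, rfl⟩, hle, -⟩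
  rcases hm.le_or_le hle with h | h
  · exact .inl ⟨c, ⟨hc.1, h, hc.2⟩, d, hd.1, rfl⟩
  · exact .inr ⟨c, hc.1, d, ⟨hd.1, h, hd.2⟩, rfl⟩

/-- Along an ultrafilter, the pairs of a finite colouring have a limit colour. -/
theorem exists_limit_colour {α K : Type*} [Finite K] (𝒰 : Ultrafilter α) (χ : α → α → K) :
    ∃ c, ∀ᶠ x in (𝒰 : Filter α), ∀ᶠ x' in (𝒰 : Filter α), χ x x' = c := by
  have key : ∀ g : α → K, ∃ c, ∀ᶠ x in (𝒰 : Filter α), g x = c := by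
    intro g
    obtain ⟨c, hc⟩ := Ultrafilter.eq_pure_of_finite (𝒰.map g)
    refine ⟨c, ?_⟩
    have : {c} ∈ 𝒰.map g := by rw [hc]; exact mem_pure.2 rfl
    exact this
  choose g hg using fun x => key (χ x)
  obtain ⟨c, hc⟩ := key g
  exact ⟨c, hc.mono fun x hx => hx ▸ hg x⟩

/-- Here the two coordinates pull in opposite directions, and tameness is what decides between them.
Ultrafilters pushing `x` up and `y` down fix the colours of generic pairs, so that one coordinate
uniformly dominates. A bound on the value then bounds the dominant coordinate. -/
theorem IsTameProduct.hasRank_upper_lower (hm : IsTameProduct m)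
    (hX : ∀ x ∈ S, ∀ x' ∈ S, ∃ ε < η, HasRank ε (image2 m (S ∩ Icc x x') T))
    (hY : ∀ y ∈ T, ∀ y' ∈ T, ∃ ε < η, HasRank ε (image2 m S (T ∩ Icc y y')))
    {x₀ : X} (hx₀ : x₀ ∈ S) {y₀ : Y} (hy₀ : y₀ ∈ T) :
    HasRank η (image2 m (S ∩ Ici x₀) (T ∩ Iic y₀)) := by
  obtain ⟨K, _, χ, ψ, hK⟩ := hm.tame
  let X' := ↥(S ∩ Ici x₀)
  let Y' := ↥(T ∩ Iic y₀)
  have : Nonempty X' := ⟨⟨x₀, hx₀, le_rfl⟩⟩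
  have : Nonempty Y' := ⟨⟨y₀, hy₀, le_rfl⟩⟩
  let 𝒰 : Ultrafilter X' := .of atTop
  let 𝒱 : Ultrafilter Y' := .of atBot
  obtain ⟨c, hc⟩ := exists_limit_colour 𝒰 fun x x' => χ x.1 x'.1
  obtain ⟨d, hd⟩ := exists_limit_colour 𝒱 fun y y' => ψ y.1 y'.1
  have hU : ∀ x : X', ∀ᶠ x' in (𝒰 : Filter X'), x ≤ x' := fun x =>
    Ultrafilter.of_le atTop (Ici_mem_atTop x)
  have hV : ∀ y : Y', ∀ᶠ y' in (𝒱 : Filter Y'), y' ≤ y := fun y =>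
    Ultrafilter.of_le atBot (Iic_mem_atBot y)
  obtain ⟨x₁, hx₁⟩ := hc.exists
  obtain ⟨y₁, hy₁⟩ := hd.exists
  obtain ⟨x₂, hx₂⟩ := hx₁.exists
  obtain ⟨y₂, hy₂⟩ := hy₁.exists
  -- The outcome for this single generic pair holds for every pair with the limit colours `c` and
  -- `d`.
  by_cases hwin : m x₁.1 y₁.1 ≤ m x₂.1 y₂.1
  · -- the first coordinate dominates
    -- Only second coordinates below the generic point `y₁` can be compared this way; the remaining
    -- strip up to `y₀` is a slice of small rank.
    have h1 : HasRank η (image2 m (S ∩ Ici x₀) (T ∩ Iic y₁.1)) := by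
      refine .of_forall_lt ?_
      rintro z - _ ⟨a, ha, b, hb, rfl⟩ -
      obtain ⟨x, hax, hx⟩ := ((hU ⟨a, ha⟩).and hc).exists
      obtain ⟨x', hx'⟩ := hx.exists
      have hbound : ∀ v : Y', m a b ≤ m x' v := by
        intro v
        obtain ⟨y', hvy, hy'⟩ := ((hV v).and hy₁).exists
        calc m a b ≤ m x b := (hm.left b).monotone hax
          _ ≤ m x y₁ := (hm.right x).monotone hb.2
          _ ≤ m x' y' := (hK _ _ _ _ _ _ _ _ (hx'.trans hx₂.symm) (hy'.trans hy₂.symm)).2 hwin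
          _ ≤ m x' v := (hm.right x').monotone hvy
      obtain ⟨ε, hε, h⟩ := hX x₀ hx₀ x' x'.2.1
      refine ⟨ε, hε, h.subset ?_⟩
      rintro _ ⟨⟨u, hu, v, hv, rfl⟩, -, hle⟩
      refine ⟨u, ⟨hu.1, hu.2, ?_⟩, v, hv.1, rfl⟩
      have hv' : v ∈ T ∩ Iic y₀ := ⟨hv.1, le_trans hv.2 y₁.2.2⟩
      exact (hm.left v).le_iff_le.1 (hle.trans (hbound ⟨v, hv'⟩))
    obtain ⟨ε, hε, h2⟩ := hY y₁ y₁.2.1 y₀ hy₀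
    refine (HasRank.union _ _ _ h1 (h2.mono_rank hε.le)).subset ?_
    rintro _ ⟨u, hu, v, hv, rfl⟩
    rcases le_total v y₁ with h | h
    · exact .inl ⟨u, hu, v, ⟨hv.1, h⟩, rfl⟩
    · exact .inr ⟨u, hu.1, v, ⟨hv.1, h, hv.2⟩, rfl⟩
  · -- the second coordinate dominates
    have h1 : HasRank η (image2 m (S ∩ Ici x₁.1) (T ∩ Iic y₀)) := by
      refine .of_forall_lt ?_
      rintro _ ⟨a, ha, b, hb, rfl⟩ z - -
      obtain ⟨y, hby, hy⟩ := ((hV ⟨b, hb⟩).and hd).exists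
      obtain ⟨y', hy'⟩ := hy.exists
      have hbound : ∀ u : X', m u y' ≤ m a b := by
        intro u
        obtain ⟨x', hux, hx'⟩ := ((hU u).and hx₁).exists
        calc m u y' ≤ m x' y' := (hm.left y').monotone hux
          _ ≤ m x₁ y := (not_le.1 fun h => hwin ((hK _ _ _ _ _ _ _ _ (hx'.trans hx₂.symm)
              (hy'.trans hy₂.symm)).1 h)).le
          _ ≤ m a y := (hm.left y).monotone ha.2
          _ ≤ m a b := (hm.right a).monotone hby
      obtain ⟨ε, hε, h⟩ := hY y' y'.2.1 y₀ hy₀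
      refine ⟨ε, hε, h.subset ?_⟩
      rintro _ ⟨⟨u, hu, v, hv, rfl⟩, hle, -⟩
      refine ⟨u, hu.1, v, ⟨hv.1, ?_, hv.2⟩, rfl⟩
      have hu' : u ∈ S ∩ Ici x₀ := ⟨hu.1, le_trans x₁.2.2 hu.2⟩
      exact (hm.right u).le_iff_le.1 ((hbound ⟨u, hu'⟩).trans hle)
    obtain ⟨ε, hε, h2⟩ := hX x₀ hx₀ x₁ x₁.2.1
    refine (HasRank.union _ _ _ h1 (h2.mono_rank hε.le)).subset ?_
    rintro _ ⟨u, hu, v, hv, rfl⟩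
    rcases le_total x₁.1 u with h | h
    · exact .inl ⟨u, ⟨hu.1, h⟩, v, hv, rfl⟩
    · exact .inr ⟨u, ⟨hu.1, hu.2, h⟩, v, hv.1, rfl⟩

/-- A point `(x₀, y₀)` cuts the product into four quadrants; the fourth is the mixed case with the
factors exchanged. -/
theorem IsTameProduct.hasRank_of_bounded (hm : IsTameProduct m)
    (hX : ∀ x ∈ S, ∀ x' ∈ S, ∃ ε < η, HasRank ε (image2 m (S ∩ Icc x x') T))
    (hY : ∀ y ∈ T, ∀ y' ∈ T, ∃ ε < η, HasRank ε (image2 m S (T ∩ Icc y y'))) :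
    HasRank η (image2 m S T) := by
  rcases S.eq_empty_or_nonempty with rfl | ⟨x₀, hx₀⟩
  · rw [image2_empty_left]; exact .of_subsingleton subsingleton_empty η
  rcases T.eq_empty_or_nonempty with rfl | ⟨y₀, hy₀⟩
  · rw [image2_empty_right]; exact .of_subsingleton subsingleton_empty η
  have h1 := hm.hasRank_upper_upper hX hY hx₀ hy₀
  have h2 := hm.hasRank_upper_lower hX hY hx₀ hy₀
  have h3 := hm.hasRank_lower_lower hX hY hx₀ hy₀
  have h4 := hm.swap.hasRank_upper_lower
    (fun y hy y' hy' => by rw [← image2_swap]; exact hY y hy y' hy')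
    (fun x hx x' hx' => by rw [← image2_swap]; exact hX x hx x' hx') hy₀ hx₀
  rw [← image2_swap] at h4
  refine (HasRank.union _ _ _ (.union _ _ _ h1 h2) (.union _ _ _ h3 h4)).subset ?_
  rintro _ ⟨u, hu, v, hv, rfl⟩
  rcases le_total x₀ u with h | h <;> rcases le_total y₀ v with h' | h'
  · exact .inl (.inl ⟨u, ⟨hu, h⟩, v, ⟨hv, h'⟩, rfl⟩)
  · exact .inl (.inr ⟨u, ⟨hu, h⟩, v, ⟨hv, h'⟩, rfl⟩)
  · exact .inr (.inr ⟨u, ⟨hu, h⟩, v, ⟨hv, h'⟩, rfl⟩)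
  · exact .inr (.inl ⟨u, ⟨hu, h⟩, v, ⟨hv, h'⟩, rfl⟩)

theorem IsTameProduct.hasRank_of_subsingleton_left (hm : IsTameProduct m) {δ : Ordinal.{u}}
    (hS : S.Subsingleton) (hT : HasRank δ T) : HasRank δ (image2 m S T) := by
  rcases hS.eq_empty_or_singleton with rfl | ⟨x, rfl⟩
  · rw [image2_empty_left]; exact .of_subsingleton subsingleton_empty δ
  · rw [image2_singleton_left]
    exact hT.image ((hm.right x).strictMonoOn T)

/-- A double induction on the two ranks: restricting either factor to a bounded interval lowers its
rank, hence strictly lowers the natural sum. -/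
theorem IsTameProduct.hasRank_image2 (hm : IsTameProduct m) {γ δ : Ordinal.{u}}
    (hS : HasRank γ S) (hT : HasRank δ T) : HasRank (nsum γ δ) (image2 m S T) := by
  induction hS generalizing T δ with
  | union γ S₁ S₂ _ _ ih₁ ih₂ =>
    rw [image2_union_left]
    exact .union _ _ _ (ih₁ hT) (ih₂ hT)
  | base γ S g hlt h ihS =>
    have hS : HasRank γ S := .base γ S g hlt h
    induction hT with
    | union δ T₁ T₂ _ _ ih₁ ih₂ =>
      rw [image2_union_right]
      exact .union _ _ _ ih₁ ih₂
    | base δ T k klt hT' ihT =>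
      have hT : HasRank δ T := .base δ T k klt hT'
      -- A base piece of rank `0` is a subsingleton. For positive ranks the degenerate slices with
      -- `x' ≤ x` or `y' ≤ y` also have rank below the sum.
      rcases eq_or_ne γ 0 with rfl | hγ
      · refine (hm.hasRank_of_subsingleton_left ?_ hT).mono_rank (le_nsum_right _ _)
        intro x hx y hy
        by_contra hne
        rcases lt_or_gt_of_ne hne with h | h
        · exact absurd (hlt x y hx hy h) (by simp)
        · exact absurd (hlt y x hy hx h) (by simp)
      rcases eq_or_ne δ 0 with rfl | hδ
      · rw [image2_swap]
        refine (hm.swap.hasRank_of_subsingleton_left ?_ hS).mono_rank (le_nsum_left _ _)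
        intro x hx y hy
        by_contra hne
        rcases lt_or_gt_of_ne hne with h | h
        · exact absurd (klt x y hx hy h) (by simp)
        · exact absurd (klt y x hy hx h) (by simp)
      refine hm.hasRank_of_bounded (fun x hx x' hx' => ?_) (fun y hy y' hy' => ?_)
      · rcases lt_or_ge x x' with hxx | hxx
        · exact ⟨_, nsum_lt_nsum_right (hlt x x' hx hx' hxx) δ, ihS x x' hx hx' hxx hT⟩
        · refine ⟨δ, (le_nsum_right 0 δ).trans_lt (nsum_lt_nsum_right (pos_iff_ne_zero.2 hγ) δ),
            hm.hasRank_of_subsingleton_left ?_ hT⟩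
          exact (subsingleton_Icc_of_ge hxx).anti inter_subset_right
      · rcases lt_or_ge y y' with hyy | hyy
        · exact ⟨_, nsum_lt_nsum_left γ (klt y y' hy hy' hyy), ihT y y' hy hy' hyy⟩
        · refine ⟨γ, (le_nsum_left γ 0).trans_lt (nsum_lt_nsum_left γ (pos_iff_ne_zero.2 hδ)), ?_⟩
          rw [image2_swap]
          refine hm.swap.hasRank_of_subsingleton_left ?_ hS
          exact (subsingleton_Icc_of_ge hyy).anti inter_subset_right

end Product

end ScatteredAutomatic

namespace ScatteredAutomatic

open Set Ordinal

/-! ### Linear orders presented by finite words and a compositional typing -/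

theorem IsScattered.of_strictMono {X B : Type u} [LinearOrder X] [LinearOrder B]
    (hB : IsScattered B) {e : X → B} (he : StrictMono e) : IsScattered X :=
  ⟨fun g => hB.false (g.trans (OrderEmbedding.ofStrictMono e he))⟩

section Words

variable {L : Type u} {S Θ : Type}

/-- `w` is a finite word whose support is contained in `I`. -/
def IsWordOn (blank : S) (I : Set L) (w : L → S) : Prop :=
  {l | w l ≠ blank}.Finite ∧ {l | w l ≠ blank} ⊆ I

/-- `θ w v` depends only on the restrictions of `w` and `v` to `I`. -/
def IsLocal (θ : (L → S) → (L → S) → Θ) (I : Set L) : Prop :=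
  ∀ w w' v v', EqOn w w' I → EqOn v v' I → θ w v = θ w' v'

/-- `K` is the disjoint union of `I` and `J`, and the type of a pair of words on `K` is determined
by its types on `I` and on `J`. -/
structure IsSplit (θK θI θJ : (L → S) → (L → S) → Θ) (K I J : Set L) : Prop where
  union : I ∪ J = K
  disjoint : Disjoint I J
  local_left : IsLocal θI I
  local_right : IsLocal θJ J
  comp : ∀ w w' v v', θI w v = θI w' v' → θJ w v = θJ w' v' → θK w v = θK w' v'

theorem IsSplit.symm {θK θI θJ : (L → S) → (L → S) → Θ} {K I J : Set L}
    (h : IsSplit θK θI θJ K I J) : IsSplit θK θJ θI K J I :=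
  ⟨union_comm I J ▸ h.union, h.disjoint.symm, h.local_right, h.local_left,
    fun w w' v v' hJ hI => h.comp w w' v v' hI hJ⟩

/-- `w` and `w'` have the same type with parameters in `P`. -/
def SameType (θ : (L → S) → (L → S) → Θ) (P : Set (L → S)) (w w' : L → S) : Prop :=
  θ w w = θ w' w' ∧ ∀ p ∈ P, θ p w = θ p w' ∧ θ w p = θ w' p

theorem SameType.refl (θ : (L → S) → (L → S) → Θ) (P : Set (L → S)) (w : L → S) :
    SameType θ P w w :=
  ⟨rfl, fun _ _ => ⟨rfl, rfl⟩⟩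

theorem SameType.trans {θ : (L → S) → (L → S) → Θ} {P : Set (L → S)} {w w' w'' : L → S}
    (h : SameType θ P w w') (h' : SameType θ P w' w'') : SameType θ P w w'' :=
  ⟨h.1.trans h'.1, fun p hp =>
    ⟨(h.2 p hp).1.trans (h'.2 p hp).1, (h.2 p hp).2.trans (h'.2 p hp).2⟩⟩

theorem SameType.symm {θ : (L → S) → (L → S) → Θ} {P : Set (L → S)} {w w' : L → S}
    (h : SameType θ P w w') : SameType θ P w' w :=
  ⟨h.1.symm, fun p hp => ⟨(h.2 p hp).1.symm, (h.2 p hp).2.symm⟩⟩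

theorem SameType.of_eqOn {θ : (L → S) → (L → S) → Θ} {P : Set (L → S)} {I : Set L}
    (hθ : IsLocal θ I) {w w' : L → S} (h : EqOn w w' I) : SameType θ P w w' :=
  ⟨hθ _ _ _ _ h h, fun p _ => ⟨hθ _ _ _ _ (eqOn_refl p I) h, hθ _ _ _ _ h (eqOn_refl p I)⟩⟩

theorem IsSplit.sameType {θK θI θJ : (L → S) → (L → S) → Θ} {K I J : Set L}
    (h : IsSplit θK θI θJ K I J) {P : Set (L → S)} {w w' : L → S} (hI : SameType θI P w w')
    (hJ : SameType θJ P w w') : SameType θK P w w' :=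
  ⟨h.comp _ _ _ _ hI.1 hJ.1, fun p hp =>
    ⟨h.comp _ _ _ _ (hI.2 p hp).1 (hJ.2 p hp).1, h.comp _ _ _ _ (hI.2 p hp).2 (hJ.2 p hp).2⟩⟩

theorem exists_finite_sameType [Finite Θ] (θ : (L → S) → (L → S) → Θ) {P : Set (L → S)}
    (hP : P.Finite) : ∃ (K : Type u) (_ : Finite K) (D : (L → S) → K),
      ∀ w w', D w = D w' → SameType θ P w w' := by
  have : Finite P := hP
  refine ⟨(P → Θ × Θ) × ULift.{u} Θ, inferInstance,
    fun w => (fun p => (θ p.1 w, θ w p.1), ⟨θ w w⟩), fun w w' h => ?_⟩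
  simp only [Prod.mk.injEq, ULift.up.injEq] at h
  refine ⟨h.2, fun p hp => ?_⟩
  have := congrFun h.1 ⟨p, hp⟩
  simpa using this

/-- The injection `f` presents the linear order `B` by finite words on `I`: its range is closed
under having the same type over the parameters `P`, and the order is determined by `θ`. -/
structure Presents (blank : S) (θ : (L → S) → (L → S) → Θ) (I : Set L) (P : Set (L → S))
    {B : Type u} [LinearOrder B] (f : B → L → S) : Prop where
  inj : Function.Injective f
  word : ∀ b, IsWordOn blank I (f b)
  sat : ∀ b w, IsWordOn blank I w → SameType θ P (f b) w → ∃ b', f b' = w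
  ord : ∀ a b a' b', θ (f a) (f b) = θ (f a') (f b') → a ≤ b → a' ≤ b'

theorem Presents.mono {blank : S} {θ : (L → S) → (L → S) → Θ} {I : Set L} {P P' : Set (L → S)}
    {B : Type u} [LinearOrder B] {f : B → L → S} (h : Presents blank θ I P f) (hP : P ⊆ P') :
    Presents blank θ I P' f :=
  ⟨h.inj, h.word, fun b w hw hs => h.sat b w hw ⟨hs.1, fun p hp => hs.2 p (hP hp)⟩, h.ord⟩

/-- The cell of `w₀`: the words on `I` of the same type as `w₀`. -/
def typeCell (blank : S) (θ : (L → S) → (L → S) → Θ) (I : Set L) (P : Set (L → S))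
    (w₀ : L → S) : Set (L → S) :=
  {w | IsWordOn blank I w ∧ SameType θ P w₀ w}

theorem IsWordOn.piecewise {blank : S} {I J K : Set L} [∀ l, Decidable (l ∈ I)]
    (hK : I ∪ J = K) {x y : L → S} (hx : IsWordOn blank I x) (hy : IsWordOn blank J y) :
    IsWordOn blank K (I.piecewise x y) := by
  have hsub : {l | I.piecewise x y l ≠ blank} ⊆ {l | x l ≠ blank} ∪ {l | y l ≠ blank} := by
    intro l hl
    by_cases h : l ∈ I
    · left; simpa [h] using hl
    · right; simpa [h] using hl
  refine ⟨(hx.1.union hy.1).subset hsub, hsub.trans (hK ▸ union_subset_union hx.2 hy.2)⟩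

theorem IsWordOn.restrict {blank : S} {I : Set L} [∀ l, Decidable (l ∈ I)] {w : L → S}
    (hw : {l | w l ≠ blank}.Finite) : IsWordOn blank I (I.piecewise w fun _ => blank) := by
  have key : ∀ l, I.piecewise w (fun _ => blank) l ≠ blank → l ∈ I ∧ w l ≠ blank := by
    intro l hl
    by_cases h : l ∈ I
    · exact ⟨h, by simpa [h] using hl⟩
    · simp [h] at hl
  exact ⟨hw.subset fun l hl => (key l hl).2, fun l hl => (key l hl).1⟩

/-- A presented order restricted to words of fixed types on both parts of a split is a tame product
of orders presented on the two parts. -/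
theorem Presents.exists_tameProduct [Finite Θ] {blank : S} {θK θI θJ : (L → S) → (L → S) → Θ}
    {K I J : Set L} (hs : IsSplit θK θI θJ K I J) {P : Set (L → S)} {B : Type u} [LinearOrder B]
    {f : B → L → S} (hf : Presents blank θK K P f) (z₀ : B) :
    ∃ (X Y : Type u) (_ : LinearOrder X) (_ : LinearOrder Y) (fX : X → L → S) (fY : Y → L → S)
      (m : X → Y → B), Presents blank θI I P fX ∧ Presents blank θJ J P fY ∧
      range fX = typeCell blank θI I P (f z₀) ∧ range fY = typeCell blank θJ J P (f z₀) ∧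
      IsTameProduct m ∧ (∃ x₀ : X, ∃ y₀ : Y, m x₀ y₀ = z₀) ∧
      ∀ z, (SameType θI P (f z₀) (f z) ∧ SameType θJ P (f z₀) (f z)) ↔ ∃ x y, m x y = z := by
  classical
  let X := typeCell blank θI I P (f z₀)
  let Y := typeCell blank θJ J P (f z₀)
  have hpJ : ∀ x y : L → S, EqOn (I.piecewise x y) y J := fun x y l hl =>
    piecewise_eq_of_notMem _ _ _ (disjoint_right.1 hs.disjoint hl)
  have hpI : ∀ x y : L → S, EqOn (I.piecewise x y) x I := fun x y => piecewise_eqOn _ _ _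
  have hmem : ∀ (x : X) (y : Y), ∃ b, f b = I.piecewise x.1 y.1 := fun x y =>
    hf.sat z₀ _ (x.2.1.piecewise hs.union y.2.1) <| hs.sameType
      (x.2.2.trans (.of_eqOn hs.local_left (hpI x.1 y.1).symm))
      (y.2.2.trans (.of_eqOn hs.local_right (hpJ x.1 y.1).symm))
  choose m hm using hmem
  have hrest : ∀ z, SameType θI P (f z₀) (f z) → SameType θJ P (f z₀) (f z) →
      ∃ x y, m x y = z := by
    intro z hzI hzJ
    refine ⟨⟨_, IsWordOn.restrict (I := I) (hf.word z).1, hzI.trans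
      (.of_eqOn hs.local_left (hpI _ _).symm)⟩, ⟨_, IsWordOn.restrict (I := J) (hf.word z).1,
      hzJ.trans (.of_eqOn hs.local_right (piecewise_eqOn J _ _).symm)⟩, hf.inj ?_⟩
    rw [hm]
    funext l
    by_cases hI : l ∈ I
    · simp [hI]
    by_cases hJ : l ∈ J
    · simp [hI, hJ]
    have : l ∉ {l | f z l ≠ blank} := fun hl => by
      have := (hf.word z).2 hl
      rw [← hs.union] at this
      exact this.elim hI hJ
    simp only [hI, hJ, not_false_eq_true, piecewise_eq_of_notMem]
    simpa [eq_comm] using this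
  obtain ⟨x₀, y₀, h₀⟩ := hrest z₀ (.refl _ _ _) (.refl _ _ _)
  have htame : ∀ x₁ x₁' x₂ x₂' y₁ y₁' y₂ y₂', θI x₁.1 x₁'.1 = θI x₂.1 x₂'.1 →
      θJ y₁.1 y₁'.1 = θJ y₂.1 y₂'.1 → m x₁ y₁ ≤ m x₁' y₁' → m x₂ y₂ ≤ m x₂' y₂' := by
    intro x₁ x₁' x₂ x₂' y₁ y₁' y₂ y₂' hI hJ
    refine hf.ord _ _ _ _ ?_
    simp only [hm]
    refine hs.comp _ _ _ _ ?_ ?_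
    · rw [hs.local_left _ _ _ _ (hpI _ _) (hpI _ _), hs.local_left _ _ _ _ (hpI _ _) (hpI _ _), hI]
    · rw [hs.local_right _ _ _ _ (hpJ _ _) (hpJ _ _), hs.local_right _ _ _ _ (hpJ _ _) (hpJ _ _),
        hJ]
  have hXinj : ∀ y, Function.Injective fun x => m x y := by
    intro y x x' h
    have h : m x y = m x' y := h
    have h2 : I.piecewise x.1 y.1 = I.piecewise x'.1 y.1 := by rw [← hm, ← hm, h]
    refine Subtype.ext (funext fun l => ?_)
    by_cases hl : l ∈ I
    · simpa [hl] using congrFun h2 l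
    · have h3 : ∀ x : X, x.1 l = blank := fun x => by_contra fun hne => hl (x.2.1.2 hne)
      rw [h3, h3]
  have hYinj : ∀ x, Function.Injective (m x) := by
    intro x y y' h
    have h2 : I.piecewise x.1 y.1 = I.piecewise x.1 y'.1 := by rw [← hm, ← hm, h]
    refine Subtype.ext (funext fun l => ?_)
    by_cases hl : l ∈ I
    · have h3 : ∀ y : Y, y.1 l = blank := fun y => by_contra fun hne =>
        disjoint_left.1 hs.disjoint hl (y.2.1.2 hne)
      rw [h3, h3]
    · simpa [hl] using congrFun h2 l
  have hXd : ∀ x x' : X, θI x.1 x.1 = θI x'.1 x'.1 := fun x x' => x.2.2.1.symm.trans x'.2.2.1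
  have hYd : ∀ y y' : Y, θJ y.1 y.1 = θJ y'.1 y'.1 := fun y y' => y.2.2.1.symm.trans y'.2.2.1
  -- The factors inherit their orders from `B` with the other coordinate fixed. The choice is
  -- immaterial: all words of a cell have the same diagonal type, so tameness transfers comparisons.
  let _ : LinearOrder X := LinearOrder.lift' (fun x => m x y₀) (hXinj y₀)
  let _ : LinearOrder Y := LinearOrder.lift' (m x₀) (hYinj x₀)
  refine ⟨X, Y, inferInstance, inferInstance, Subtype.val, Subtype.val, m, ?_, ?_,
    Subtype.range_coe, Subtype.range_coe, ?_, ⟨x₀, y₀, h₀⟩, fun z => ⟨fun h => hrest z h.1 h.2, ?_⟩⟩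
  · refine ⟨Subtype.val_injective, fun x => x.2.1, fun x w hw h =>
      ⟨⟨w, hw, x.2.2.trans h⟩, rfl⟩, fun a b a' b' h hab => ?_⟩
    exact htame _ _ _ _ _ _ _ _ h rfl hab
  · refine ⟨Subtype.val_injective, fun x => x.2.1, fun x w hw h =>
      ⟨⟨w, hw, x.2.2.trans h⟩, rfl⟩, fun a b a' b' h hab => ?_⟩
    exact htame _ _ _ _ _ _ _ _ rfl h hab
  · refine ⟨fun y x x' hx => ?_, fun x y y' hy => ?_, Θ, inferInstance, fun x x' => θI x.1 x'.1,
      fun y y' => θJ y.1 y'.1, fun x₁ x₁' x₂ x₂' y₁ y₁' y₂ y₂' hI hJ =>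
        ⟨htame _ _ _ _ _ _ _ _ hI hJ, htame _ _ _ _ _ _ _ _ hI.symm hJ.symm⟩⟩
    · refine lt_of_not_ge fun h => ?_
      exact absurd hx (not_lt.2 (htame _ _ _ _ _ _ _ _ rfl (hYd y y₀) h))
    · refine lt_of_not_ge fun h => ?_
      exact absurd hy (not_lt.2 (htame _ _ _ _ _ _ _ _ (hXd x x₀) rfl h))
  · rintro ⟨x, y, rfl⟩
    rw [hm]
    exact ⟨x.2.2.trans (.of_eqOn hs.local_left (hpI x.1 y.1).symm),
      y.2.2.trans (.of_eqOn hs.local_right (hpJ x.1 y.1).symm)⟩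

/-- Every scattered linear order presented by finite words on `I` has rank below `β`. -/
def RankBound (blank : S) (θ : (L → S) → (L → S) → Θ) (I : Set L) (β : Ordinal.{u}) : Prop :=
  ∀ P : Set (L → S), P.Finite → (∀ p ∈ P, {l | p l ≠ blank}.Finite) →
    ∀ (B : Type u) [LinearOrder B], IsScattered B → ∀ f : B → L → S, Presents blank θ I P f →
      ∃ γ < β, HasRank γ (univ : Set B)

theorem RankBound.mono {blank : S} {θ : (L → S) → (L → S) → Θ} {I : Set L} {β β' : Ordinal.{u}}
    (h : RankBound blank θ I β) (hβ : β ≤ β') : RankBound blank θ I β' :=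
  fun P hP hP' B _ hB f hf =>
    let ⟨γ, hγ, hr⟩ := h P hP hP' B hB f hf
    ⟨γ, hγ.trans_le hβ, hr⟩

/-- Finitely many parameters and types give finitely many cells, so it suffices to bound each cell.
-/
theorem exists_hasRank_of_sameType [Finite Θ] {θI θJ : (L → S) → (L → S) → Θ} {P : Set (L → S)}
    (hP : P.Finite) {B : Type u} [LinearOrder B] {f : B → L → S} {η : Ordinal.{u}} (hη : η ≠ 0)
    {U : Set B} (h : ∀ z₀ ∈ U, ∃ δ < η,
      HasRank δ {z | SameType θI P (f z₀) (f z) ∧ SameType θJ P (f z₀) (f z)}) :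
    ∃ δ < η, HasRank δ U := by
  obtain ⟨K, _, D, hD⟩ := exists_finite_sameType θI hP
  obtain ⟨K', _, D', hD'⟩ := exists_finite_sameType θJ hP
  obtain ⟨δ, hδ, hr⟩ := exists_hasRank_iUnion hη
    (C := fun k : K × K' => {z | z ∈ U ∧ D (f z) = k.1 ∧ D' (f z) = k.2}) (by
      rintro k
      rcases {z | z ∈ U ∧ D (f z) = k.1 ∧ D' (f z) = k.2}.eq_empty_or_nonempty with he | ⟨z₀, hz₀⟩
      · rw [he]
        exact ⟨0, pos_iff_ne_zero.2 hη, .of_subsingleton subsingleton_empty 0⟩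
      · obtain ⟨δ, hδ, hr⟩ := h z₀ hz₀.1
        exact ⟨δ, hδ, hr.subset fun z hz => ⟨hD _ _ (hz₀.2.1.trans hz.2.1.symm),
          hD' _ _ (hz₀.2.2.trans hz.2.2.symm)⟩⟩)
  exact ⟨δ, hδ, hr.subset fun z hz => mem_iUnion.2 ⟨(D (f z), D' (f z)), hz, rfl, rfl⟩⟩

theorem RankBound.of_split [Finite Θ] {blank : S} {θK θI θJ : (L → S) → (L → S) → Θ}
    {K I J : Set L} (hs : IsSplit θK θI θJ K I J) {α : Ordinal.{u}}
    (hI : RankBound blank θI I (ω ^ α)) (hJ : RankBound blank θJ J (ω ^ α)) :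
    RankBound blank θK K (ω ^ α) := by
  intro P hP hP' B _ hB f hf
  refine exists_hasRank_of_sameType hP (θI := θI) (θJ := θJ) (f := f)
    (opow_pos α omega0_pos).ne' fun z₀ _ => ?_
  obtain ⟨X, Y, _, _, fX, fY, m, hX, hY, -, -, hm, ⟨x₀, y₀, -⟩, hz⟩ := hf.exists_tameProduct hs z₀
  obtain ⟨γ, hγ, hrX⟩ := hI P hP hP' X (hB.of_strictMono (hm.left y₀)) fX hX
  obtain ⟨δ, hδ, hrY⟩ := hJ P hP hP' Y (hB.of_strictMono (hm.right x₀)) fY hY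
  refine ⟨nsum γ δ, nsum_lt_opow α γ hγ δ hδ, (hm.hasRank_image2 hrX hrY).subset fun z hz' => ?_⟩
  obtain ⟨x, y, rfl⟩ := (hz z).1 hz'
  exact ⟨x, mem_univ x, y, mem_univ y, rfl⟩

/-- Both orders live on the same set of words. If every type realised by `≤` in `Y` is also realised
by `≤` in `X`, the identification of words preserves strict inequality from `X` to `Y`. -/
theorem Presents.hasRank_congr {blank : S} {θ : (L → S) → (L → S) → Θ} {I : Set L}
    {P : Set (L → S)} {X Y : Type u} [LinearOrder X] [LinearOrder Y] {fX : X → L → S}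
    {fY : Y → L → S} (hX : Presents blank θ I P fX)
    (hr : range fY = range fX)
    (hT : ∀ y y', y ≤ y' → ∃ x x', x ≤ x' ∧ θ (fX x) (fX x') = θ (fY y) (fY y')) {γ : Ordinal.{u}}
    (h : HasRank γ (univ : Set Y)) : HasRank γ (univ : Set X) := by
  have : ∀ x, ∃ y, fY y = fX x := fun x => by
    have : fX x ∈ range fX := ⟨x, rfl⟩
    rwa [← hr] at this
  choose e he using this
  refine h.of_strictMonoOn e ?_ (mapsTo_univ _ _)
  intro x _ x' _ hlt
  refine lt_of_not_ge fun hle => ?_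
  obtain ⟨a, a', haa, h⟩ := hT _ _ hle
  rw [he, he] at h
  exact absurd (hX.ord _ _ _ _ h haa) (not_le.2 hlt)

/-- By locality, parameters blank on `J` act like the blank word, so three elements of `Θ` determine
the cell however many parameters there are. -/
theorem typeCell_eq_of_blank {blank : S} {θ : (L → S) → (L → S) → Θ} {J : Set L}
    (hθ : IsLocal θ J) {P : Set (L → S)} (hP : ∀ p ∈ P, EqOn p (fun _ => blank) J)
    {w w' : L → S} (h₁ : θ w w = θ w' w')
    (h₂ : θ (fun _ => blank) w = θ (fun _ => blank) w')
    (h₃ : θ w (fun _ => blank) = θ w' (fun _ => blank)) :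
    typeCell blank θ J P w = typeCell blank θ J P w' := by
  have : SameType θ P w w' := by
    refine ⟨h₁, fun p hp => ⟨?_, ?_⟩⟩
    · rw [hθ p _ w w (hP p hp) (eqOn_refl _ _), h₂, hθ p _ w' w' (hP p hp) (eqOn_refl _ _)]
    · rw [hθ w w p _ (eqOn_refl _ _) (hP p hp), h₃, hθ w' w' p _ (eqOn_refl _ _) (hP p hp)]
  ext x
  exact ⟨fun h => ⟨h.1, this.symm.trans h.2⟩, fun h => ⟨h.1, this.trans h.2⟩⟩

theorem RankBound.of_finite [Finite S] {θ : (L → S) → (L → S) → Θ} {K : Set L} (hK : K.Finite) :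
    RankBound blank θ K (ω ^ (0 : Ordinal.{u})) := by
  intro P _ _ B _ _ f hf
  have : Finite K := hK
  have hB : Finite B := by
    refine Finite.of_injective (fun b (l : K) => f b l) fun a b hab => hf.inj (funext fun l => ?_)
    by_cases hl : l ∈ K
    · exact congrFun hab ⟨l, hl⟩
    · have h : ∀ b, f b l = blank := fun b => by_contra fun hne => hl ((hf.word b).2 hne)
      rw [h, h]
  refine ⟨0, by simp, (HasRank.iUnion fun b : B =>
    HasRank.of_subsingleton (subsingleton_singleton (a := b)) 0).subset fun b _ => ?_⟩
  exact mem_iUnion.2 ⟨b, rfl⟩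

/-- If every finite set of positions can be separated from the rest of `K` by a part of small
rank bound, then the rank bound of `K` grows only by one exponent. -/
theorem RankBound.of_forall_split [Finite Θ] {blank : S} {θK : (L → S) → (L → S) → Θ} {K : Set L}
    {α : Ordinal.{u}} (h : ∀ F : Set L, F.Finite → ∃ (θI θJ : (L → S) → (L → S) → Θ) (I J : Set L),
      IsSplit θK θI θJ K I J ∧ Disjoint F J ∧ RankBound blank θI I (ω ^ α)) :
    RankBound blank θK K (ω ^ (α + 1)) := by
  intro P hP hP' B _ hB f hf
  by_contra hcon
  push Not at hcon
  have hno : ∀ n : ℕ, ¬ HasRank (ω ^ α * ((n + 1 : ℕ) : Ordinal.{u})) (univ : Set B) := fun n =>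
    hcon _ (by
      rw [← Order.succ_eq_add_one]
      exact lt_omega0_opow_succ.2 ⟨n + 1 + 1, by
        have := opow_mul_add_lt (opow_pos α omega0_pos) (Nat.lt_succ_self (n + 1))
        rwa [add_zero] at this⟩)
  choose p q hpq hle hge using fun n => hB.exists_interval_rank (hno n)
  -- The number of codes is fixed by `Θ` alone, before the intervals and their endpoint parameters
  -- are chosen.
  let N := Nat.card (Set Θ × Θ × Θ × Θ)
  let P' := P ∪ ⋃ n : Fin (N + 1), {f (p n), f (q n)}
  have hPP' : P ⊆ P' := subset_union_left
  have hP'fin : P'.Finite := hP.union (finite_iUnion fun n => toFinite _)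
  have hP'w : ∀ w ∈ P', {l | w l ≠ blank}.Finite := by
    rintro w (hw | hw)
    · exact hP' w hw
    · obtain ⟨n, rfl | rfl⟩ := mem_iUnion.1 hw
      · exact (hf.word _).1
      · exact (hf.word _).1
  have hpP : ∀ n : Fin (N + 1), f (p n) ∈ P' := fun n => .inr (mem_iUnion.2 ⟨n, .inl rfl⟩)
  have hqP : ∀ n : Fin (N + 1), f (q n) ∈ P' := fun n => .inr (mem_iUnion.2 ⟨n, .inr rfl⟩)
  obtain ⟨θI, θJ, I, J, hs, hFJ, hI⟩ := h (⋃ w ∈ P', {l | w l ≠ blank}) (hP'fin.biUnion hP'w)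
  have hblank : ∀ w ∈ P', EqOn w (fun _ => blank) J := by
    intro w hw l hl
    by_contra hne
    exact disjoint_right.1 hFJ hl (mem_biUnion hw hne)
  have hf' := hf.mono hPP'
  -- With the endpoints as parameters, each cell meeting the interval lies inside it. If every
  -- factor on `J` had rank `ω ^ α * n`, adding a factor on `I` of rank below `ω ^ α` would keep
  -- each cell, hence the interval, below `ω ^ α * (n + 1)`.
  have key : ∀ n : Fin (N + 1), ∃ (z : B) (Y : Type u) (_ : LinearOrder Y) (fY : Y → L → S),
      Presents blank θJ J P' fY ∧ range fY = typeCell blank θJ J P' (f z) ∧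
      HasRank (ω ^ α * ((n + 1 : ℕ) : Ordinal.{u})) (univ : Set Y) ∧
      ¬ HasRank (ω ^ α * (n : ℕ)) (univ : Set Y) := by
    intro n
    by_contra hcon'
    push Not at hcon'
    obtain ⟨δ, hδ, hr⟩ := exists_hasRank_of_sameType hP'fin (θI := θI) (θJ := θJ) (f := f)
      (η := ω ^ α * ((n + 1 : ℕ) : Ordinal.{u})) (U := Icc (p n) (q n))
      (mul_ne_zero (opow_pos α omega0_pos).ne' (Nat.cast_ne_zero.2 (Nat.succ_ne_zero _))) (by
        intro z₀ hz₀
        obtain ⟨X, Y, _, _, fX, fY, m, hX, hY, -, hrY, hm, ⟨x₀, y₀, -⟩, hz⟩ :=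
          hf'.exists_tameProduct hs z₀
        have hmIcc : ∀ x y, m x y ∈ Icc (p n) (q n) := by
          intro x y
          obtain ⟨h1, h2⟩ := (hz (m x y)).2 ⟨x, y, rfl⟩
          have h3 := hs.sameType h1 h2
          exact ⟨hf.ord _ _ _ _ (h3.2 _ (hpP n)).1 hz₀.1, hf.ord _ _ _ _ (h3.2 _ (hqP n)).2 hz₀.2⟩
        obtain ⟨γ, hγ, hrX⟩ := hI P' hP'fin hP'w X (hB.of_strictMono (hm.left y₀)) fX hX
        have hrankY := hcon' z₀ Y inferInstance fY hY hrY
          ((hle n).of_strictMonoOn (m x₀) ((hm.right x₀).strictMonoOn _) fun y _ => hmIcc x₀ y)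
        refine ⟨_, nsum_lt_opow_mul hγ n, (hm.hasRank_image2 hrX hrankY).subset fun z hz' => ?_⟩
        obtain ⟨x, y, rfl⟩ := (hz z).1 hz'
        exact ⟨x, mem_univ x, y, mem_univ y, rfl⟩)
    exact hge n δ hδ hr
  choose z Y hLY fY hY hrY hup hlow using key
  -- The first component fixes the order on the factor; the other three fix its set of words.
  let code (n : Fin (N + 1)) : Set Θ × Θ × Θ × Θ :=
    ({t | ∃ y y' : Y n, y ≤ y' ∧ θJ (fY n y) (fY n y') = t}, θJ (f (z n)) (f (z n)),
      θJ (fun _ => blank) (f (z n)), θJ (f (z n)) (fun _ => blank))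
  have hcode : ∀ n k, code n = code k → ¬ n < k := by
    intro n k hnk hlt
    simp only [code, Prod.mk.injEq] at hnk
    obtain ⟨h1, h2, h3, h4⟩ := hnk
    refine hlow k (HasRank.mono_rank ((hY k).hasRank_congr (fY := fY n) ?_ ?_ (hup n)) ?_)
    · rw [hrY, hrY]
      exact typeCell_eq_of_blank hs.local_right hblank h2 h3 h4
    · intro y y' hyy
      have : θJ (fY n y) (fY n y') ∈ {t | ∃ y y' : Y k, y ≤ y' ∧ θJ (fY k y) (fY k y') = t} := by
        rw [← h1]
        exact ⟨y, y', hyy, rfl⟩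
      exact this
    · gcongr
      exact_mod_cast hlt
  have := Fintype.ofFinite (Set Θ × Θ × Θ × Θ)
  obtain ⟨n, k, hne, heq⟩ := Fintype.exists_ne_map_eq_of_card_lt code (by
    rw [Fintype.card_fin, ← Nat.card_eq_fintype_card]
    exact Nat.lt_succ_self _)
  rcases lt_or_gt_of_ne hne with hlt | hlt
  · exact hcode n k heq hlt
  · exact hcode k n heq.symm hlt

end Words

end ScatteredAutomatic

namespace ScatteredAutomatic

open Set Ordinal

/-! ### Types of words between two cuts -/

section Runs

variable {L : Type u} [LinearOrder L] {S Q : Type}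

theorem limBelow_subset {r r' : Cuts L → Q} {c e : Cuts L} (hce : c < e)
    (h : ∀ x, c ≤ x → x < e → r x = r' x) : limBelow r e ⊆ limBelow r' e := by
  intro q hq d hd
  obtain ⟨x, hdx, hxe, rfl⟩ := hq (max d c) (max_lt hd hce)
  exact ⟨x, (le_max_left _ _).trans hdx, hxe, (h x ((le_max_right _ _).trans hdx) hxe).symm⟩

theorem limBelow_congr {r r' : Cuts L → Q} {c e : Cuts L} (hce : c < e)
    (h : ∀ x, c ≤ x → x < e → r x = r' x) : limBelow r e = limBelow r' e :=
  (limBelow_subset hce h).antisymm (limBelow_subset hce fun x hx hx' => (h x hx hx').symm)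

theorem limAbove_subset {r r' : Cuts L → Q} {c e : Cuts L} (hce : c < e)
    (h : ∀ x, c < x → x ≤ e → r x = r' x) : limAbove r c ⊆ limAbove r' c := by
  intro q hq d hd
  obtain ⟨x, hcx, hxd, rfl⟩ := hq (min d e) (lt_min hd hce)
  exact ⟨x, hcx, hxd.trans (min_le_left _ _), (h x hcx (hxd.trans (min_le_right _ _))).symm⟩

theorem limAbove_congr {r r' : Cuts L → Q} {c e : Cuts L} (hce : c < e)
    (h : ∀ x, c < x → x ≤ e → r x = r' x) : limAbove r c = limAbove r' c :=
  (limAbove_subset hce h).antisymm (limAbove_subset hce fun x hx hx' => (h x hx hx').symm)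

/-- The positions between two cuts. -/
def between (c d : Cuts L) : Set L := {l | l ∈ d ∧ l ∉ c}

theorem le_Iio_of_notMem {c : Cuts L} {l : L} (h : l ∉ c) : c ≤ LowerSet.Iio l := fun _ hx =>
  lt_of_not_ge fun hle => h (c.lower hle hx)

theorem Iic_le_of_mem {d : Cuts L} {l : L} (h : l ∈ d) : LowerSet.Iic l ≤ d := fun _ hx =>
  d.lower hx h

theorem Iio_lt_Iic (l : L) : LowerSet.Iio l < LowerSet.Iic l :=
  lt_of_le_not_ge (fun _ => le_of_lt) fun h => lt_irrefl l (h le_rfl)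

/-- The run conditions of an automaton between the cuts `c` and `d`. -/
structure Automaton.IsRunBetween (M : Automaton S Q) (c d : Cuts L) (w : L → S)
    (r : Cuts L → Q) : Prop where
  succ : ∀ l ∈ between c d, (r (LowerSet.Iio l), w l, r (LowerSet.Iic l)) ∈ M.succTrans
  rightLim : ∀ e, c < e → e ≤ d → (¬ ∃ x, x ⋖ e) → (limBelow r e, r e) ∈ M.rightLimTrans
  leftLim : ∀ e, c ≤ e → e < d → (¬ ∃ x, e ⋖ x) → (r e, limAbove r e) ∈ M.leftLimTrans

/-- The pairs of states joined by a run between the cuts `c` and `d`. -/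
def Automaton.pathType (M : Automaton S Q) (c d : Cuts L) (w : L → S) : Set (Q × Q) :=
  {x | ∃ r, M.IsRunBetween c d w r ∧ r c = x.1 ∧ r d = x.2}

theorem Automaton.pathType_congr (M : Automaton S Q) {c d : Cuts L} {w w' : L → S}
    (h : EqOn w w' (between c d)) : M.pathType c d w = M.pathType c d w' := by
  have key : ∀ {w w' : L → S}, EqOn w w' (between c d) →
      M.pathType c d w ⊆ M.pathType c d w' := by
    rintro w w' h _ ⟨r, hr, h1, h2⟩
    exact ⟨r, ⟨fun l hl => h hl ▸ hr.succ l hl, hr.rightLim, hr.leftLim⟩, h1, h2⟩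
  exact (key h).antisymm (key h.symm)

/-- Runs agreeing at `d` can be glued, since a one-sided limit depends only on values on that side.
At `d` itself the limit from below belongs to the first run and the limit from above to the second.
-/
theorem Automaton.mem_pathType_trans (M : Automaton S Q) {c d e : Cuts L} (hcd : c ≤ d)
    (hde : d ≤ e) (w : L → S) (p q : Q) :
    (p, q) ∈ M.pathType c e w ↔ ∃ s, (p, s) ∈ M.pathType c d w ∧ (s, q) ∈ M.pathType d e w := by
  classical
  constructor
  · rintro ⟨r, hr, h1, h2⟩
    refine ⟨r d, ⟨r, ⟨fun l hl => hr.succ l ⟨hde hl.1, hl.2⟩,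
      fun x hx hx' => hr.rightLim x hx (hx'.trans hde),
      fun x hx hx' => hr.leftLim x hx (hx'.trans_le hde)⟩, h1, rfl⟩,
      ⟨r, ⟨fun l hl => hr.succ l ⟨hl.1, fun h => hl.2 (hcd h)⟩,
      fun x hx hx' => hr.rightLim x (hcd.trans_lt hx) hx',
      fun x hx hx' => hr.leftLim x (hcd.trans hx) hx'⟩, rfl, h2⟩⟩
  · rintro ⟨s, ⟨r₁, hr₁, h₁, h₁'⟩, ⟨r₂, hr₂, h₂, h₂'⟩⟩
    let r : Cuts L → Q := fun x => if x ≤ d then r₁ x else r₂ x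
    have hle : ∀ x, x ≤ d → r x = r₁ x := fun x hx => if_pos hx
    have hge : ∀ x, d ≤ x → r x = r₂ x := by
      intro x hx
      rcases hx.eq_or_lt with rfl | hx
      · exact (if_pos le_rfl).trans (h₁'.trans h₂.symm)
      · exact if_neg (not_le.2 hx)
    refine ⟨r, ⟨fun l hl => ?_, fun x hx hx' hlim => ?_, fun x hx hx' hlim => ?_⟩,
      (hle c hcd).trans h₁, (hge e hde).trans h₂'⟩
    · by_cases hld : l ∈ d
      · have := Iic_le_of_mem hld
        rw [hle _ ((Iio_lt_Iic l).le.trans this), hle _ this]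
        exact hr₁.succ l ⟨hld, hl.2⟩
      · have := le_Iio_of_notMem hld
        rw [hge _ this, hge _ (this.trans (Iio_lt_Iic l).le)]
        exact hr₂.succ l ⟨hl.1, hld⟩
    · rcases le_or_gt x d with hxd | hxd
      · rw [hle x hxd, limBelow_congr hx fun y _ hy => hle y (hy.le.trans hxd)]
        exact hr₁.rightLim x hx hxd hlim
      · rw [hge x hxd.le, limBelow_congr hxd fun y hy _ => hge y hy]
        exact hr₂.rightLim x hxd hx' hlim
    · rcases lt_or_ge x d with hxd | hxd
      · rw [hle x hxd.le, limAbove_congr hxd fun y _ hy => hle y hy]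
        exact hr₁.leftLim x hx hxd hlim
      · rw [hge x hxd, limAbove_congr hx' fun y hy _ => hge y (hxd.trans hy.le)]
        exact hr₂.leftLim x hxd hx' hlim

theorem Automaton.accepts_iff (M : Automaton S Q) (w : L → S) :
    M.Accepts w ↔ ∃ x ∈ M.pathType ⊥ ⊤ w, x.1 ∈ M.init ∧ x.2 ∈ M.final := by
  constructor
  · rintro ⟨r, hr, h1, h2⟩
    exact ⟨(r ⊥, r ⊤), ⟨r, ⟨fun l _ => hr.succ l, fun e he _ => hr.rightLim e he.ne',
      fun e _ he => hr.leftLim e he.ne⟩, rfl, rfl⟩, h1, h2⟩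
  · rintro ⟨⟨p, q⟩, ⟨r, hr, h1, h2⟩, hp, hq⟩
    refine ⟨r, ⟨fun l => hr.succ l ⟨trivial, id⟩, fun e he =>
      hr.rightLim e (bot_lt_iff_ne_bot.2 he) le_top, fun e he =>
      hr.leftLim e bot_le (lt_top_iff_ne_top.2 he)⟩, h1.symm ▸ hp, h2.symm ▸ hq⟩

end Runs

/-! ### The main induction -/

section Main

variable {L : Type u} [LinearOrder L] {S Θ : Type}

/-- A family of typings for the intervals between two cuts that is local and compositional. -/
structure IsCompositional (θ : Cuts L → Cuts L → (L → S) → (L → S) → Θ) : Prop where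
  isLocal : ∀ c d, IsLocal (θ c d) (between c d)
  comp : ∀ c d e, c ≤ d → d ≤ e → ∀ w w' v v', θ c d w v = θ c d w' v' →
    θ d e w v = θ d e w' v' → θ c e w v = θ c e w' v'

variable {θ : Cuts L → Cuts L → (L → S) → (L → S) → Θ} {blank : S}

theorem IsCompositional.isSplit (hθ : IsCompositional θ) {c d e : Cuts L} (hcd : c ≤ d)
    (hde : d ≤ e) : IsSplit (θ c e) (θ c d) (θ d e) (between c e) (between c d) (between d e) where
  union := by
    ext l
    constructor
    · rintro (h | h)
      · exact ⟨hde h.1, h.2⟩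
      · exact ⟨h.1, fun hc => h.2 (hcd hc)⟩
    · intro h
      by_cases hl : l ∈ d
      · exact .inl ⟨hl, h.2⟩
      · exact .inr ⟨h.1, hl⟩
  disjoint := disjoint_left.2 fun _ h h' => h'.2 h.1
  local_left := hθ.isLocal c d
  local_right := hθ.isLocal d e
  comp := hθ.comp c d e hcd hde

theorem FinClasses.finite {K : Set L} (h : FinClasses 0 K) : K.Finite := by
  refine Set.Finite.of_finite_image h fun x _ y _ hxy => ?_
  exact (condensation_zero L x y).1 (setOf_condensation_eq_iff.1 hxy)

theorem finClasses_Icc_of_condensation {α : Ordinal.{u}} {x y : L}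
    (h : condensation L (1 + α) x y) (hxy : x ≤ y) : ∃ γ < 1 + α, FinClasses γ (Icc x y) := by
  rcases (condensation_iff _ x y).1 h with rfl | ⟨γ, hγ, h⟩
  · refine ⟨0, zero_lt_one.trans_le le_self_add, ?_⟩
    rw [Icc_self]
    exact (finite_singleton x).image _
  · rw [uIcc_of_le hxy] at h
    exact ⟨γ, hγ, h⟩

section Step

variable [Finite Θ] {α : Ordinal.{u}}

/-- Cut at a point `x₀`. On either side, a finite set of positions is enclosed between `x₀` and its
extreme point `x₁`, and this closed interval is small because `x₀` and `x₁` are equivalent. -/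
theorem IsCompositional.rankBound_of_condensation [Finite S] (hθ : IsCompositional θ)
    (small : ∀ γ < 1 + α, ∀ c d, c ≤ d → FinClasses γ (between c d) →
      RankBound blank (θ c d) (between c d) (ω ^ α)) {c d : Cuts L}
    (h : ∀ x ∈ between c d, ∀ y ∈ between c d, condensation L (1 + α) x y) :
    RankBound blank (θ c d) (between c d) (ω ^ (α + 1)) := by
  rcases (between c d).eq_empty_or_nonempty with he | ⟨x₀, hx₀⟩
  · exact (RankBound.of_finite (by rw [he]; exact finite_empty)).mono
      (opow_le_opow_right omega0_pos (by simp))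
  have h1 : c ≤ LowerSet.Iic x₀ := (le_Iio_of_notMem hx₀.2).trans (Iio_lt_Iic x₀).le
  have h2 : LowerSet.Iic x₀ ≤ d := Iic_le_of_mem hx₀.1
  refine RankBound.of_split (hθ.isSplit h1 h2) (.of_forall_split fun F hF => ?_)
    (.of_forall_split fun F hF => ?_)
  · obtain ⟨x₁, hx₁, hmin⟩ := Set.exists_min_image (insert x₀ (F ∩ between c (LowerSet.Iic x₀))) id
      ((hF.inter_of_left _).insert x₀) (insert_nonempty _ _)
    have hx₁' : x₁ ∈ between c (LowerSet.Iic x₀) := by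
      rcases hx₁ with rfl | hx₁
      · exact ⟨le_rfl, hx₀.2⟩
      · exact hx₁.2
    have hc : c ≤ LowerSet.Iio x₁ := le_Iio_of_notMem hx₁'.2
    have he : LowerSet.Iio x₁ ≤ LowerSet.Iic x₀ := (Iio_lt_Iic x₁).le.trans (Iic_le_of_mem hx₁'.1)
    -- Below `x₀` the part containing `F` is the right half of the split, hence the exchange.
    refine ⟨_, _, _, _, (hθ.isSplit hc he).symm, disjoint_left.2 fun l hl hl' => ?_, ?_⟩
    · exact absurd (show l < x₁ from hl'.1) (not_lt.2 (hmin l (.inr ⟨hl, he hl'.1, hl'.2⟩)))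
    · obtain ⟨γ, hγ, hfin⟩ := finClasses_Icc_of_condensation
        (h x₁ ⟨h2 hx₁'.1, hx₁'.2⟩ x₀ hx₀) hx₁'.1
      exact small γ hγ _ _ he (hfin.subset fun l hl => ⟨not_lt.1 hl.2, hl.1⟩)
  · obtain ⟨x₁, hx₁, hmax⟩ := Set.exists_max_image (insert x₀ (F ∩ between (LowerSet.Iic x₀) d)) id
      ((hF.inter_of_left _).insert x₀) (insert_nonempty _ _)
    have hx₁' : x₀ ≤ x₁ ∧ x₁ ∈ d := by
      rcases hx₁ with rfl | hx₁
      · exact ⟨le_rfl, hx₀.1⟩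
      · exact ⟨(not_le.1 hx₁.2.2).le, hx₁.2.1⟩
    have hc : LowerSet.Iic x₀ ≤ LowerSet.Iic x₁ := Iic_le_of_mem hx₁'.1
    have he : LowerSet.Iic x₁ ≤ d := Iic_le_of_mem hx₁'.2
    refine ⟨_, _, _, _, hθ.isSplit hc he, disjoint_left.2 fun l hl hl' => ?_, ?_⟩
    · exact hl'.2 (hmax l (.inr ⟨hl, hl'.1, fun h => hl'.2 (hc h)⟩))
    · obtain ⟨γ, hγ, hfin⟩ := finClasses_Icc_of_condensation
        (h x₀ hx₀ x₁ ⟨hx₁'.2, fun h => hx₀.2 (c.lower hx₁'.1 h)⟩) hx₁'.1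
      exact small γ hγ _ _ hc (hfin.subset fun l hl => ⟨(not_le.1 hl.2).le, hl.1⟩)

/-- The part below, and the part up to, the class of `x`, inside an interval of cuts. -/
theorem exists_cuts_around_class (γ : Ordinal.{u}) {c d : Cuts L} (hcd : c ≤ d) {x : L}
    (hx : x ∈ between c d) : ∃ e₁ e₂ : Cuts L, c ≤ e₁ ∧ e₁ ≤ e₂ ∧ e₂ ≤ d ∧
      (∀ y ∈ between c e₁, ¬ condensation L γ y x) ∧ (∀ y ∈ between e₁ e₂, condensation L γ y x) ∧
      ∀ y ∈ between e₂ d, ¬ condensation L γ y x := by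
  obtain ⟨heq, hconv, -⟩ := condensation_aux L γ
  refine ⟨⟨{y | y ∈ c ∨ (y ∈ d ∧ y < x ∧ ¬ condensation L γ y x)}, ?_⟩,
    ⟨{y | y ∈ d ∧ (y < x ∨ condensation L γ y x)}, ?_⟩, fun y hy => .inl hy, ?_, fun y hy => hy.1,
    ?_, ?_, ?_⟩
  · rintro y z hzy (hy | ⟨hy, hyx, hne⟩)
    · exact .inl (c.lower hzy hy)
    · refine .inr ⟨d.lower hzy hy, hzy.trans_lt hyx, fun h => hne ?_⟩
      have := hconv z x h y (by rw [uIcc_of_le (hzy.trans hyx.le)]; exact ⟨hzy, hyx.le⟩)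
      exact heq.trans (heq.symm this) h
  · rintro y z hzy ⟨hy, hyx⟩
    refine ⟨d.lower hzy hy, ?_⟩
    rcases lt_or_ge z x with h | h
    · exact .inl h
    · rcases hyx with hyx | hyx
      · exact absurd (h.trans hzy) (not_le.2 hyx)
      · exact .inr (heq.symm (hconv x y (heq.symm hyx) z
          (by rw [uIcc_of_le (h.trans hzy)]; exact ⟨h, hzy⟩)))
  · rintro y (hy | hy)
    · exact ⟨hcd hy, .inl (lt_of_not_ge fun h => hx.2 (c.lower h hy))⟩
    · exact ⟨hy.1, .inl hy.2.1⟩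
  · rintro y ⟨hy | hy, hyc⟩
    · exact absurd hy hyc
    · exact hy.2.2
  · rintro y ⟨⟨hyd, hy | hy⟩, hyc⟩
    · by_contra hne
      exact hyc (.inr ⟨hyd, hy, hne⟩)
    · exact hy
  · rintro y ⟨hyd, hy⟩ h
    exact hy ⟨hyd, .inr h⟩

/-- Induction on the number of classes met: convexity lets one class be cut out, leaving fewer
classes on each side. -/
theorem IsCompositional.rankBound_step [Finite S] (hθ : IsCompositional θ)
    (small : ∀ γ < 1 + α, ∀ c d, c ≤ d → FinClasses γ (between c d) →
      RankBound blank (θ c d) (between c d) (ω ^ α)) (n : ℕ) {c d : Cuts L} (hcd : c ≤ d)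
    (h : FinClasses (1 + α) (between c d))
    (hn : ((fun z => {w | condensation L (1 + α) z w}) '' between c d).ncard ≤ n) :
    RankBound blank (θ c d) (between c d) (ω ^ (α + 1)) := by
  induction n generalizing c d with
  | zero =>
    have : (between c d) = ∅ := by
      rw [Nat.le_zero, Set.ncard_eq_zero h, image_eq_empty] at hn
      exact hn
    exact hθ.rankBound_of_condensation small (by simp [this])
  | succ n ih =>
    rcases (between c d).eq_empty_or_nonempty with he | ⟨x, hx⟩
    · exact hθ.rankBound_of_condensation small (by simp [he])
    obtain ⟨e₁, e₂, h1, h2, h3, hlow, hmid, hup⟩ := exists_cuts_around_class (1 + α) hcd hx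
    have key : ∀ T ⊆ between c d, (∀ y ∈ T, ¬ condensation L (1 + α) y x) →
        ((fun z => {w | condensation L (1 + α) z w}) '' T).ncard ≤ n := by
      intro T hT hTx
      refine Nat.lt_succ_iff.1 ((Set.ncard_lt_ncard ⟨image_mono hT, fun hsub => ?_⟩ h).trans_le hn)
      obtain ⟨y, hy, hyx⟩ := hsub ⟨x, hx, rfl⟩
      exact hTx y hy (setOf_condensation_eq_iff.1 hyx)
    have hsub1 : between c e₁ ⊆ between c d := fun l hl => ⟨h3 (h2 hl.1), hl.2⟩
    have hsub3 : between e₂ d ⊆ between c d := fun l hl => ⟨hl.1, fun h => hl.2 (h2 (h1 h))⟩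
    have he := (condensation_aux L (1 + α)).1
    refine RankBound.of_split (hθ.isSplit h1 (h2.trans h3))
      (ih h1 (h.subset hsub1) (key _ hsub1 hlow)) (RankBound.of_split (hθ.isSplit h2 h3)
        (hθ.rankBound_of_condensation small fun y hy z hz =>
          he.trans (hmid y hy) (he.symm (hmid z hz)))
        (ih h3 (h.subset hsub3) (key _ hsub3 hup)))

end Step

theorem IsCompositional.rankBound [Finite S] [Finite Θ] (hθ : IsCompositional θ)
    (α : Ordinal.{u}) {c d : Cuts L} (hcd : c ≤ d) (h : FinClasses (1 + α) (between c d)) :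
    RankBound blank (θ c d) (between c d) (ω ^ (α + 1)) := by
  induction α using WellFoundedLT.induction generalizing c d with
  | ind α ih =>
  refine hθ.rankBound_step (fun γ hγ c d hcd h => ?_) _ hcd h le_rfl
  -- This is where the shift `1 + α` enters. Stage `0` means finitely many positions, with bound `ω
  -- ^ 0`; a stage `γ = 1 + (γ - 1)` has bound `ω ^ (γ - 1 + 1) ≤ ω ^ α`.
  rcases eq_or_ne γ 0 with rfl | hγ0
  · exact (RankBound.of_finite h.finite).mono (opow_le_opow_right omega0_pos (by simp))
  · have h1 : (1 : Ordinal.{u}) ≤ γ := Order.one_le_iff_pos.2 (pos_iff_ne_zero.2 hγ0)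
    rw [← Ordinal.add_sub_cancel_of_le h1] at hγ h
    have hlt : γ - 1 < α := lt_of_add_lt_add_left hγ
    exact (ih _ hlt hcd h).mono (opow_le_opow_right omega0_pos (Order.add_one_le_of_lt hlt))

end Main

/-! ### Automatic orders -/

section Automatic

variable {L : Type u} [LinearOrder L] {A : Type u} [LinearOrder A]

theorem Automaton.isCompositional {S T Q : Type} (N : Automaton (S × S × T) Q) (o : L → T) :
    IsCompositional fun (c d : Cuts L) (w v : L → S) => N.pathType c d (conv w (conv v o)) where
  isLocal c d w w' v v' hw hv := N.pathType_congr fun l hl => by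
    simp only [conv, hw hl, hv hl]
  comp c d e hcd hde w w' v v' h1 h2 := by
    ext ⟨p, q⟩
    rw [N.mem_pathType_trans hcd hde, N.mem_pathType_trans hcd hde, h1, h2]

theorem IsFiniteWordOracleAutomaticOrder.exists_presents
    (hA : IsFiniteWordOracleAutomaticOrder L A) :
    ∃ (S Θ : Type) (_ : Finite S) (_ : Finite Θ) (blank : S)
      (θ : Cuts L → Cuts L → (L → S) → (L → S) → Θ) (f : A → L → S),
      IsCompositional θ ∧ Presents blank (θ ⊥ ⊤) (between ⊥ ⊤) ∅ f := by
  obtain ⟨T, _, o, S, hS, blank, f, -, -, -, Q, hQ, N, hinj, hfin, -, hN⟩ := hA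
  refine ⟨S, Set (Q × Q), hS, inferInstance, blank, _, f, N.isCompositional o, hinj,
    fun b => ⟨hfin b, fun l _ => ⟨trivial, id⟩⟩, fun b w _ h => ?_, fun a b a' b' h hab => ?_⟩
  -- Reflexivity of `≤` puts `(w, w)` in the recognised relation exactly for words `w` of the
  -- domain, so the diagonal type detects membership.
  · have h1 := (hN (f b) (f b)).2 ⟨b, b, rfl, rfl, le_rfl⟩
    rw [N.accepts_iff, show N.pathType ⊥ ⊤ (conv (f b) (conv (f b) o)) = _ from h.1,
      ← N.accepts_iff, hN] at h1
    obtain ⟨a, -, ha, -⟩ := h1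
    exact ⟨a, ha⟩
  · have h1 := (hN (f a) (f b)).2 ⟨a, b, rfl, rfl, hab⟩
    rw [N.accepts_iff, show N.pathType ⊥ ⊤ (conv (f a) (conv (f b) o)) = _ from h,
      ← N.accepts_iff, hN] at h1
    obtain ⟨x, y, hx, hy, hxy⟩ := h1
    rwa [hinj hx, hinj hy] at hxy

theorem FCstar_le_of_hasRank {γ : Ordinal.{u}} (h : HasRank γ (univ : Set A)) : FCstar A ≤ γ :=
  csInf_le' (h.finClasses ordConnected_univ).finite_quotient

theorem IsScattered.finClasses_FCstar (hL : IsScattered L) (K : Set L) :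
    FinClasses (FCstar L) K := by
  have : Finite (Quotient (condensationSetoid L (FCstar L))) := csInf_mem hL.exists_finite_quotient
  exact FinClasses.of_finite K

theorem IsFiniteWordOracleAutomaticOrder.exists_hasRank (hL : IsScattered L) {α : Ordinal.{u}}
    (hα : FCstar L = 1 + α) (hA : IsScattered A) (h : IsFiniteWordOracleAutomaticOrder L A) :
    ∃ γ < ω ^ (α + 1), HasRank γ (univ : Set A) := by
  obtain ⟨S, Θ, _, _, blank, θ, f, hθ, hf⟩ := h.exists_presents
  exact hθ.rankBound (blank := blank) α bot_le (hα ▸ hL.finClasses_FCstar _) ∅ finite_empty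
    (by simp) A hA f hf

end Automatic

/-! ### Ordinals -/

section Ordinals

variable {β : Ordinal.{u}}

/-- Points at distance `ω ^ γ` are inequivalent, so the progression meets infinitely many classes.
-/
theorem not_finClasses_of_progression {γ x : Ordinal.{u}}
    (hγ : ∀ a b : Iio β, a ≤ b → condensation β.ToType γ (ToType.mk a) (ToType.mk b) →
      b.1 < a.1 + ω ^ γ) (hβ : ∀ n : ℕ, x + ω ^ γ * n < β) {S : Set β.ToType}
    (hS : ∀ n : ℕ, ToType.mk ⟨x + ω ^ γ * n, hβ n⟩ ∈ S) : ¬ FinClasses γ S := by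
  intro h
  have : Finite ((fun z => {w | condensation β.ToType γ z w}) '' S) := h
  obtain ⟨m, n, hne, heq⟩ := Finite.exists_ne_map_eq_of_infinite fun n : ℕ =>
    (⟨_, _, hS n, rfl⟩ : ↥((fun z => {w | condensation β.ToType γ z w}) '' S))
  have key : ∀ m n : ℕ, m < n → ¬ condensation β.ToType γ (ToType.mk ⟨x + ω ^ γ * m, hβ m⟩)
      (ToType.mk ⟨x + ω ^ γ * n, hβ n⟩) := by
    intro m n hmn hc
    have hle : x + ω ^ γ * (m : Ordinal.{u}) + ω ^ γ ≤ x + ω ^ γ * n := by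
      rw [add_assoc, ← mul_add_one]
      gcongr
      exact_mod_cast hmn
    exact absurd (hγ ⟨_, hβ m⟩ ⟨_, hβ n⟩ (Subtype.coe_le_coe.1 (le_self_add.trans hle :)) hc)
      (not_lt.2 hle)
  have hc := setOf_condensation_eq_iff.1 (Subtype.ext_iff.1 heq)
  rcases lt_or_gt_of_ne hne with hlt | hlt
  · exact key m n hlt hc
  · exact key n m hlt ((condensation_aux _ γ).1.symm hc)

/-- If `b` were at least `a + ω ^ γ`, then for each `δ < γ` the interval would contain all `a + ω ^
δ * n`, as `ω ^ (δ + 1) ≤ ω ^ γ`, and thus infinitely many `∼_δ`-classes. -/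
theorem lt_add_opow_of_condensation (γ : Ordinal.{u}) (a b : Iio β) (hab : a ≤ b)
    (h : condensation β.ToType γ (ToType.mk a) (ToType.mk b)) : b.1 < a.1 + ω ^ γ := by
  induction γ using WellFoundedLT.induction generalizing a b with
  | ind γ ih =>
  rcases (condensation_iff γ _ _).1 h with h | ⟨δ, hδ, h⟩
  · rw [ToType.mk.injective h]
    exact lt_add_of_pos_right _ (opow_pos γ omega0_pos)
  · by_contra hle
    rw [not_lt] at hle
    have hb : ∀ n : ℕ, a.1 + ω ^ δ * n ≤ b.1 := by
      intro n
      refine le_trans ?_ hle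
      gcongr
      calc ω ^ δ * (n : Ordinal.{u}) ≤ ω ^ δ * ω := by gcongr; exact (natCast_lt_omega0 n).le
        _ = ω ^ (δ + 1) := by rw [opow_add, opow_one]
        _ ≤ ω ^ γ := opow_le_opow_right omega0_pos (Order.add_one_le_of_lt hδ)
    refine not_finClasses_of_progression (ih δ hδ) (fun n => (hb n).trans_lt b.2)
      (fun n => ?_) h
    rw [uIcc_of_le (ToType.mk.monotone hab)]
    exact ⟨ToType.mk.monotone (Subtype.coe_le_coe.1 le_self_add), ToType.mk.monotone (hb n)⟩

theorem lt_opow_of_hasRank {γ : Ordinal.{u}} (h : HasRank γ (univ : Set β.ToType)) :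
    β < ω ^ (γ + 1) := by
  by_contra hle
  rw [not_lt] at hle
  refine not_finClasses_of_progression (x := 0) (lt_add_opow_of_condensation γ) (fun n => ?_)
    (fun n => mem_univ _) (h.finClasses ordConnected_univ)
  rw [zero_add]
  refine lt_of_lt_of_le ?_ hle
  rw [opow_add, opow_one]
  exact mul_lt_mul_of_pos_left (natCast_lt_omega0 n) (opow_pos γ omega0_pos)

theorem isScattered_toType (β : Ordinal.{u}) : IsScattered β.ToType := by
  refine ⟨fun g => ?_⟩
  have hg : ∀ a : β.ToType, ∀ q : ℚ, g q ≠ a := by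
    intro a
    induction a using WellFoundedLT.induction with
    | ind a ih =>
      intro q hq
      -- A copy of the rationals would descend forever: the value at `q - 1` is a smaller point of
      -- the range.
      exact ih (g (q - 1)) (hq ▸ g.strictMono (by linarith)) (q - 1) rfl
  exact hg _ 0 rfl

end Ordinals

end ScatteredAutomatic

/-! ### The theorem -/

theorem mainTheorem1 (L : Type u) [LinearOrder L] (hL : ScatteredAutomatic.IsScattered L) :
    (∀ α : Ordinal.{u}, ScatteredAutomatic.FCstar L = 1 + α →
      (∀ (A : Type u) [LinearOrder A], ScatteredAutomatic.IsScattered A →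
        ScatteredAutomatic.IsFiniteWordOracleAutomaticOrder L A →
        ScatteredAutomatic.FCstar A < Ordinal.omega0 ^ (α + 1)) ∧
      (∀ β : Ordinal.{u},
        ScatteredAutomatic.IsFiniteWordOracleAutomaticOrder L β.ToType →
        β < Ordinal.omega0 ^ (Ordinal.omega0 ^ (α + 1)))) ∧
    (ScatteredAutomatic.FCstar L = 0 →
      ∀ (A : Type u) [LinearOrder A], ScatteredAutomatic.IsScattered A →
        ScatteredAutomatic.IsFiniteWordOracleAutomaticOrder L A →
        ScatteredAutomatic.FCstar A < 1 ∧ Finite A) := by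
  refine ⟨fun α hα => ⟨fun A _ hA h => ?_, fun β h => ?_⟩, fun h0 A _ hA h => ?_⟩
  · obtain ⟨γ, hγ, hr⟩ := h.exists_hasRank hL hα hA
    exact (ScatteredAutomatic.FCstar_le_of_hasRank hr).trans_lt hγ
  · obtain ⟨γ, hγ, hr⟩ := h.exists_hasRank hL hα (ScatteredAutomatic.isScattered_toType β)
    refine (ScatteredAutomatic.lt_opow_of_hasRank hr).trans_le
      (Ordinal.opow_le_opow_right Ordinal.omega0_pos (Order.add_one_le_of_lt hγ))
  · obtain ⟨S, Θ, _, _, blank, θ, f, hθ, hf⟩ := h.exists_presents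
    have hfin : (ScatteredAutomatic.between (⊥ : ScatteredAutomatic.Cuts L) ⊤).Finite :=
      ScatteredAutomatic.FinClasses.finite (h0 ▸ hL.finClasses_FCstar _)
    obtain ⟨γ, hγ, hr⟩ := ScatteredAutomatic.RankBound.of_finite (blank := blank) hfin
      ∅ Set.finite_empty (by simp) A hA f hf
    rw [Ordinal.opow_zero] at hγ
    refine ⟨(ScatteredAutomatic.FCstar_le_of_hasRank hr).trans_lt hγ, ?_⟩
    -- Rank `0` on the whole order means finitely many classes of equality.
    rw [Order.lt_one_iff.1 hγ] at hr
    exact Set.finite_univ_iff.1 (hr.finClasses Set.ordConnected_univ).finite
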